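/- **Corollary 2.5 (quasigordian).** For $n\ge 2$ let $\mathcal K_{H(n)}$ be the $H(n)$-Gordian graph: its vertices are the unoriented knots (up to isotopy), and two distinct knots $K$, $K'$ span an edge if they possess knot diagrams $D$, $D'$ related by an $H(n)$-move or its inverse. Here an $H(n)$-move alters a diagram only within a disc whose boundary meets the diagram in $2n$ points $e_1,\dots,e_{2n}$ (in their order around the boundary): a pattern of $n$ disjoint crossingless arcs joining $e_1e_2,\ e_3e_4,\ \dots,\ e_{2n-1}e_{2n}$ is replaced by the pattern of $n$ disjoint crossingless arcs joining $e_2e_3,\ \dots,\ e_{2n-2}e_{2n-1},\ e_{2n}e_1$, and only moves that turn a diagram of a knot into a diagram of a knot are allowed. A connected graph is regarded as a geodesic metric space, a one-dimensional complex with edges of length $1$ and the path metric. For every $n\ge 3$, the graphs $\mathcal K_{H(n)}$ and $\mathcal K_{H(2)}$ are connected, and $\mathcal K_{H(n)}$ is quasi-isometric to $\mathcal K_{H(2)}$: there are a map $f:\mathcal K_{H(n)}\to\mathcal K_{H(2)}$ and constants $a\ge 1$, $b\ge 0$, $C\ge 0$ such that $$\frac1a\, d(x,x')-b\le d(f(x),f(x'))\le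 a\, d(x,x')+b\qquad\text{for all } x,x'\in\mathcal K_{H(n)},$$ and every $y\in\mathcal K_{H(2)}$ satisfies $d(y,f(x))\le C$ for some $x\in\mathcal K_{H(n)}$. -/

import Mathlib

/-! ### Knot diagrams in the plane

A diagram is put in general position with respect to the height function and cut by horizontal
lines into slices, each of which holds a single cup (minimum), cap (maximum) or crossing, next to
vertical strands. The diagram is recorded as the list of its slices, from bottom to top. -/

namespace KnotTheory

/-- The kinds of critical points of a diagram in general position. A crossing consists of a rising
strand, which runs from the bottom left to the top right, and a falling strand, which runs from
the top left to the bottom right; the rising strand is the upper one in `crossing true`, the lower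
one in `crossing false`. -/
inductive Kind
  | cup
  | cap
  | crossing (b : Bool)

/-- Number of strands that enter the critical point from below. -/
def Kind.inp : Kind → ℕ
  | .cup => 0
  | .cap => 2
  | .crossing _ => 2

/-- Number of strands that leave the critical point upwards. -/
def Kind.out : Kind → ℕ
  | .cup => 2
  | .cap => 0
  | .crossing _ => 2

/-- A slice: one critical point with `pos` vertical strands to the left of it. Strands on a
horizontal line are numbered `0, 1, 2, …` from left to right. -/
structure Slice where
  kind : Kind
  pos : ℕ

abbrev cup (i : ℕ) : Slice := ⟨.cup, i⟩
abbrev cap (i : ℕ) : Slice := ⟨.cap, i⟩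
abbrev crossing (b : Bool) (i : ℕ) : Slice := ⟨.crossing b, i⟩

/-- `IsTangle k w l`: the slices `w` fit together, with `k` strands at the bottom and `l` strands
at the top. -/
def IsTangle : ℕ → List Slice → ℕ → Prop
  | k, [], l => k = l
  | k, s :: w, l => s.pos + s.kind.inp ≤ k ∧ IsTangle (k - s.kind.inp + s.kind.out) w l

/-- `(t, p)` stands for the `p`-th strand on the horizontal line above the first `t` slices. -/
def IsPoint (w : List Slice) (x : ℕ × ℕ) : Prop :=
  ∃ k, IsTangle 0 (w.take x.1) k ∧ x.2 < k

/-- Two points of the diagram are the two ends of an arc of the diagram within one slice. -/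
inductive Joined (w : List Slice) : ℕ × ℕ → ℕ × ℕ → Prop
  | left (t p : ℕ) (s : Slice) : w[t]? = some s → p < s.pos → Joined w (t, p) (t + 1, p)
  | right (t p : ℕ) (s : Slice) : w[t]? = some s → s.pos ≤ p →
      Joined w (t, p + s.kind.inp) (t + 1, p + s.kind.out)
  | cup (t i : ℕ) : w[t]? = some (cup i) → Joined w (t + 1, i) (t + 1, i + 1)
  | cap (t i : ℕ) : w[t]? = some (cap i) → Joined w (t, i) (t, i + 1)
  | rising (t i : ℕ) (b : Bool) : w[t]? = some (crossing b i) → Joined w (t, i) (t + 1, i + 1)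
  | falling (t i : ℕ) (b : Bool) : w[t]? = some (crossing b i) → Joined w (t, i + 1) (t + 1, i)

/-- `w` is a closed diagram with exactly one component. -/
def IsKnotDiagram (w : List Slice) : Prop :=
  IsTangle 0 w 0 ∧ w ≠ [] ∧
    ∀ x y, IsPoint w x → IsPoint w y → Relation.EqvGen (Joined w) x y

/-- Unoriented knot diagrams. -/
structure KnotDiagram where
  word : List Slice
  isKnot : IsKnotDiagram word

/-! ### Planar isotopy, Reidemeister moves and knots -/

/-- The elementary planar isotopies of sliced diagrams and the Reidemeister moves. -/
inductive BasicMove : List Slice → List Slice → Prop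
  /-- Planar isotopy: of two critical points side by side, either may be the higher one. -/
  | exchange (a b : Kind) (i j : ℕ) : i ≤ j →
      BasicMove [⟨a, i⟩, ⟨b, j + a.out⟩] [⟨b, j + a.inp⟩, ⟨a, i⟩]
  /-- Planar isotopy: a minimum and a maximum that follow each other on a strand cancel. -/
  | zigzag_left (i : ℕ) : BasicMove [cup i, cap (i + 1)] []
  | zigzag_right (i : ℕ) : BasicMove [cup (i + 1), cap i] []
  /-- Planar isotopy: a crossing turns around a minimum or a maximum. -/
  | cup_crossing (b : Bool) (i : ℕ) :
      BasicMove [cup i, crossing b (i + 1)] [cup (i + 1), crossing (!b) i]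
  | crossing_cap (b : Bool) (i : ℕ) :
      BasicMove [crossing b (i + 1), cap i] [crossing (!b) i, cap (i + 1)]
  /-- First Reidemeister move. -/
  | reidemeister1_cup (b : Bool) (i : ℕ) : BasicMove [cup i, crossing b i] [cup i]
  | reidemeister1_cap (b : Bool) (i : ℕ) : BasicMove [crossing b i, cap i] [cap i]
  /-- Second Reidemeister move. -/
  | reidemeister2 (b : Bool) (i : ℕ) : BasicMove [crossing b i, crossing (!b) i] []
  /-- Third Reidemeister move. -/
  | reidemeister3 (b : Bool) (i : ℕ) :
      BasicMove [crossing b i, crossing b (i + 1), crossing b i]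
        [crossing b (i + 1), crossing b i, crossing b (i + 1)]

/-- `D'` is obtained from `D` by replacing a part of `D` as prescribed by `R`. -/
def LocalMove (R : List Slice → List Slice → Prop) (D D' : KnotDiagram) : Prop :=
  ∃ u a b v, R a b ∧ D.word = u ++ a ++ v ∧ D'.word = u ++ b ++ v

/-- Unoriented knots (isotopy classes of knots in space): knot diagrams up to the equivalence
relation generated by planar isotopies and Reidemeister moves. -/
def Knot : Type := Quot (LocalMove BasicMove)

/-- The knot that a diagram represents. -/
def KnotDiagram.knot (D : KnotDiagram) : Knot := Quot.mk _ D

/-! ### `H(n)`-moves and Gordian graphs -/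

/-- The two patterns of the `H(n)`-move. Let `e₁, …, e₂ₙ` be the points in which a disc meets the
diagram, in their order around the boundary of the disc, drawn here along the bottom of the disc.
The first pattern joins `e₁e₂, e₃e₄, …, e₂ₙ₋₁e₂ₙ` by `n` disjoint arcs without crossings,
the second joins `e₂e₃, …, e₂ₙ₋₂e₂ₙ₋₁, e₂ₙe₁` in this way. -/
inductive HPattern (n : ℕ) : List Slice → List Slice → Prop
  | mk (i : ℕ) : HPattern n (List.replicate n (cap i))
      (List.replicate (n - 1) (cap (i + 1)) ++ [cap i])

/-- The `H(n)`-Gordian graph: its vertices are the unoriented knots, and two distinct knots are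
adjacent if they have knot diagrams related by an `H(n)`-move or its inverse. -/
def gordianGraph (n : ℕ) : SimpleGraph Knot :=
  SimpleGraph.fromRel fun K K' =>
    ∃ D D' : KnotDiagram, D.knot = K ∧ D'.knot = K' ∧ LocalMove (HPattern n) D D'

/-! ### Graphs as metric spaces -/

/-- The points of a graph regarded as a one-dimensional complex with edges of length one, in
barycentric coordinates: the point `x` of an edge `vw` at distance `t` from `v` has the coordinates
`1 - t` at `v` and `t` at `w`, and a vertex `v` has the coordinate `1` at `v`. -/
structure Realization {V : Type*} (G : SimpleGraph V) where
  coord : V →₀ ℝ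
  nonneg : ∀ v, 0 ≤ coord v
  sum_eq_one : (coord.sum fun _ t => t) = 1
  card_support : coord.support.card ≤ 2
  adj_of_ne : ∀ v ∈ coord.support, ∀ w ∈ coord.support, v ≠ w → G.Adj v w

variable {V : Type*} {G : SimpleGraph V}

/-- The two points lie on a common edge, or are the same vertex. -/
def Realization.SameEdge (x y : Realization G) : Prop :=
  ∃ v w, (v = w ∨ G.Adj v w) ∧ (∀ u, x.coord u ≠ 0 ∨ y.coord u ≠ 0 → u = v ∨ u = w)

open Classical in
/-- The path metric of a connected graph. On a common edge `vw` the distance is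
`|x v - y v| = |x w - y w|`; otherwise it is the minimum of `d(x, v) + d(v, w) + d(w, y)` over the
endpoints `v`, `w` of the edges that carry `x` and `y`, where `d(v, w)` is the minimum number of
edges of a path from `v` to `w`, and `d(x, v) = 1 - x v`. -/
noncomputable instance : Dist (Realization G) where
  dist x y :=
    if x.SameEdge y then (∑ u ∈ x.coord.support ∪ y.coord.support, |x.coord u - y.coord u|) / 2
    else ⨅ p : x.coord.support × y.coord.support,
      (1 - x.coord p.1) + (G.dist (p.1 : V) (p.2 : V) : ℝ) + (1 - y.coord p.2)

/-- Two metric spaces are quasi-isometric. -/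
def QuasiIsometric (X Y : Type*) [Dist X] [Dist Y] : Prop :=
  ∃ (f : X → Y) (a b C : ℝ), 1 ≤ a ∧ 0 ≤ b ∧ 0 ≤ C ∧
    (∀ x x', 1 / a * dist x x' - b ≤ dist (f x) (f x') ∧ dist (f x) (f x') ≤ a * dist x x' + b) ∧
    ∀ y, ∃ x, dist y (f x) ≤ C

end KnotTheory

/-!
# Gordian graphs of `H(n)`-moves

All Gordian graphs of `H(n)`-moves have the same vertices, so it suffices to compare the distances.
An `H(n)`-move is an `H(n + 1)`-move after a curl has been added to one of the strands
(`gordianGraph_le_succ`), so the distances do not increase with `n`. Conversely an `H(n)`-move decomposes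
into at most `2 * (n - 1)` moves `H(2)` all of whose intermediate diagrams are knots
(`withinDist_of_hMove`). The graph for `n = 2` is connected because a crossing of a knot diagram can
always be smoothed by an `H(2)`-move such that the result is again a knot (`withinDist_unknot`), and
a diagram without crossings is trivial (`knotOf_eq_unknot`).

The question which of the intermediate diagrams are knots is answered by colourings. Label the arcs
of a diagram by elements of `ZMod 2`; the diagram is a knot if and only if all its colourings are
constant (`isKnotDiagram_iff`). This is invariant under isotopies and Reidemeister moves
(`BasicMove.run_iff`). For a diagram with a hole, the colours at the ends of the hole form an
isotropic subspace with respect to the standard bilinear form, since the two ends of each arc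
contribute equally (`Run.pairing_eq`). Isotropy gives at once that, of the two smoothings of a
crossing of a knot diagram, one is a knot (`IsMonochromatic.smoothing`).

Let the two patterns of an `H(n)`-move both give knots. If a surgery on two neighbouring arcs of the
first pattern gives a knot, then this surgery is an `H(2)`-move and an `H(n - 1)`-move remains to be
done. Otherwise the surgery on the first two arcs has a nonconstant colouring, in which the ends
`e₁` and `e₂` have different colours. Since the second pattern gives a knot, another change of
colours occurs between two neighbouring arcs. By isotropy, the surgery on these two arcs gives
a knot after the ends `e₂` and `e₃` have been crossed (`exists_surgery`); the crossing can be created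
by one `H(2)`-move, and in the second pattern it is removed by a first Reidemeister move.
-/

namespace KnotTheory

/-! ### Tangle words and their equivalence -/

theorem IsTangle.append {j k l : ℕ} {u v : List Slice} (hu : IsTangle j u k)
    (hv : IsTangle k v l) : IsTangle j (u ++ v) l := by
  induction u generalizing j with
  | nil => cases hu; exact hv
  | cons s u ih => exact ⟨hu.1, ih hu.2⟩

theorem isTangle_append {j l : ℕ} {u v : List Slice} :
    IsTangle j (u ++ v) l ↔ ∃ k, IsTangle j u k ∧ IsTangle k v l := by
  refine ⟨fun h => ?_, fun ⟨k, hu, hv⟩ => hu.append hv⟩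
  induction u generalizing j with
  | nil => exact ⟨j, rfl, h⟩
  | cons s u ih =>
    obtain ⟨k, hk, hv⟩ := ih h.2
    exact ⟨k, ⟨h.1, hk⟩, hv⟩

theorem IsTangle.unique {k l l' : ℕ} {w : List Slice} (h : IsTangle k w l)
    (h' : IsTangle k w l') : l = l' := by
  induction w generalizing k with
  | nil => exact h.symm.trans h'
  | cons s w ih => exact ih h.2 h'.2

/-- One application of a planar isotopy or a Reidemeister move inside a tangle word. -/
def TangleMove (k l : ℕ) (w w' : List Slice) : Prop :=
  IsTangle k w l ∧ IsTangle k w' l ∧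
    ∃ u a b v, BasicMove a b ∧ w = u ++ a ++ v ∧ w' = u ++ b ++ v

/-- Two tangle words with `k` strands at the bottom and `l` at the top represent isotopic
tangles. -/
def Isotopic (k l : ℕ) : List Slice → List Slice → Prop :=
  Relation.EqvGen (TangleMove k l)

namespace Isotopic

variable {j k l m : ℕ} {a b c : List Slice}

theorem refl (a : List Slice) : Isotopic k l a a := Relation.EqvGen.refl a

theorem symm (h : Isotopic k l a b) : Isotopic k l b a := Relation.EqvGen.symm _ _ h

theorem trans (h : Isotopic k l a b) (h' : Isotopic k l b c) : Isotopic k l a c :=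
  Relation.EqvGen.trans _ _ _ h h'

theorem context {u v : List Slice} (h : Isotopic k l a b) (hu : IsTangle j u k)
    (hv : IsTangle l v m) : Isotopic j m (u ++ a ++ v) (u ++ b ++ v) := by
  induction h with
  | rel a b h =>
    obtain ⟨ha, hb, u', x, y, v', hxy, rfl, rfl⟩ := h
    exact Relation.EqvGen.rel _ _ ⟨(hu.append ha).append hv, (hu.append hb).append hv,
      u ++ u', x, y, v' ++ v, hxy, by simp, by simp⟩
  | refl => exact .refl _
  | symm _ _ _ ih => exact ih.symm
  | trans _ _ _ _ _ ih ih' => exact ih.trans ih'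

/-- Slices above two isotopic tangle words. -/
theorem above (v : List Slice) (h : Isotopic k l a b) (hv : IsTangle l v m) :
    Isotopic k m (a ++ v) (b ++ v) :=
  h.context (u := []) rfl hv

/-- Slices below two isotopic tangle words. -/
theorem below (u : List Slice) (h : Isotopic k l a b) (hu : IsTangle j u k) :
    Isotopic j l (u ++ a) (u ++ b) := by
  simpa using h.context (v := []) hu rfl

end Isotopic

/-! ### Colourings -/

/-- Colours of the strands on a horizontal line. Only the colours of the strands that are there
matter; the formulas below also make sense for the positions to the right of them. -/
abbrev State : Type := ℕ → ZMod 2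

namespace State

/-- Two new strands of colour `e` at the positions `i` and `i + 1`. -/
def insertPair (i : ℕ) (e : ZMod 2) (f : State) : State :=
  fun p => if p < i then f p else if p < i + 2 then e else f (p - 2)

/-- The strands at the positions `i` and `i + 1` are dropped. -/
def deletePair (i : ℕ) (f : State) : State :=
  fun p => if p < i then f p else f (p + 2)

/-- The strands at the positions `i` and `i + 1` trade places. -/
def swapPair (i : ℕ) (f : State) : State :=
  fun p => if p = i then f (i + 1) else if p = i + 1 then f i else f p

section

variable {i p : ℕ} {e : ZMod 2} {f : State}

theorem insertPair_of_lt (h : p < i) : insertPair i e f p = f p := if_pos h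

theorem insertPair_add_two (h : i ≤ p) : insertPair i e f (p + 2) = f p := by
  simp only [insertPair]; rw [if_neg (by omega), if_neg (by omega)]; rfl

@[simp] theorem insertPair_left : insertPair i e f i = e := by simp [insertPair]

@[simp] theorem insertPair_right : insertPair i e f (i + 1) = e := by simp [insertPair]

theorem deletePair_of_lt (h : p < i) : deletePair i f p = f p := if_pos h

theorem deletePair_of_le (h : i ≤ p) : deletePair i f p = f (p + 2) := if_neg (by omega)

@[simp] theorem swapPair_left : swapPair i f i = f (i + 1) := by simp [swapPair]

@[simp] theorem swapPair_right : swapPair i f (i + 1) = f i := by simp [swapPair]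

theorem swapPair_of_lt (h : p < i) : swapPair i f p = f p := by
  simp only [swapPair]; rw [if_neg (by omega), if_neg (by omega)]

theorem swapPair_of_le (h : i + 2 ≤ p) : swapPair i f p = f p := by
  simp only [swapPair]; rw [if_neg (by omega), if_neg (by omega)]

end

/-- The colours that occur on the first `k` strands. -/
def colours (k : ℕ) (f : State) : Set (ZMod 2) := {e | ∃ p < k, f p = e}

end State

open State

/-- `Run w f g A`: the strands of the word `w` can be coloured consistently along the arcs, so that
the colours are `f` at the bottom and `g` at the top, and `A` is the set of the colours of the
cups. -/
def Run : List Slice → State → State → Set (ZMod 2) → Prop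
  | [], f, g, A => f = g ∧ A = ∅
  | ⟨.cup, i⟩ :: w, f, g, A => ∃ e B, A = insert e B ∧ Run w (insertPair i e f) g B
  | ⟨.cap, i⟩ :: w, f, g, A => f i = f (i + 1) ∧ Run w (deletePair i f) g A
  | ⟨.crossing _, i⟩ :: w, f, g, A => Run w (swapPair i f) g A

section

variable {k l i : ℕ} {b : Bool} {w u v : List Slice} {f g : State} {A B : Set (ZMod 2)}

@[simp] theorem run_nil : Run [] f g A ↔ f = g ∧ A = ∅ := Iff.rfl

@[simp] theorem run_cap : Run (cap i :: w) f g A ↔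
    f i = f (i + 1) ∧ Run w (deletePair i f) g A := Iff.rfl

@[simp] theorem run_crossing : Run (crossing b i :: w) f g A ↔ Run w (swapPair i f) g A := Iff.rfl

theorem run_append : Run (u ++ v) f g A ↔
    ∃ h B C, A = B ∪ C ∧ Run u f h B ∧ Run v h g C := by
  induction u generalizing f A with
  | nil =>
    constructor
    · intro h; exact ⟨f, ∅, A, by simp, ⟨rfl, rfl⟩, h⟩
    · rintro ⟨h, B, C, rfl, ⟨rfl, rfl⟩, hC⟩; simpa using hC
  | cons s u ih =>
    obtain ⟨_ | _ | c, i⟩ := s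
    · simp only [List.cons_append, Run, ih]
      constructor
      · rintro ⟨e, _, rfl, h, B, C, rfl, hB, hC⟩
        exact ⟨h, insert e B, C, by rw [Set.insert_union], ⟨e, B, rfl, hB⟩, hC⟩
      · rintro ⟨h, _, C, rfl, ⟨e, B, rfl, hB⟩, hC⟩
        exact ⟨e, B ∪ C, by rw [Set.insert_union], h, B, C, rfl, hB, hC⟩
    · simp only [List.cons_append, Run, ih]
      constructor
      · rintro ⟨hi, h, B, C, rfl, hB, hC⟩; exact ⟨h, B, C, rfl, ⟨hi, hB⟩, hC⟩
      · rintro ⟨h, B, C, rfl, ⟨hi, hB⟩, hC⟩; exact ⟨hi, h, B, C, rfl, hB, hC⟩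
    · simp only [List.cons_append, Run, ih]

theorem colours_insertPair (h : i ≤ k) (e : ZMod 2) (f : State) :
    colours (k + 2) (insertPair i e f) ⊆ insert e (colours k f) := by
  rintro _ ⟨p, hp, rfl⟩
  unfold insertPair
  split_ifs with h1 h2
  · exact Or.inr ⟨p, by omega, rfl⟩
  · exact Or.inl rfl
  · exact Or.inr ⟨p - 2, by omega, rfl⟩

theorem colours_deletePair (h : i + 2 ≤ k) (f : State) :
    colours (k - 2) (deletePair i f) ⊆ colours k f := by
  rintro _ ⟨p, hp, rfl⟩
  unfold deletePair
  split_ifs with h1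
  · exact ⟨p, by omega, rfl⟩
  · exact ⟨p + 2, by omega, rfl⟩

theorem colours_swapPair (h : i + 2 ≤ k) (f : State) :
    colours k (swapPair i f) ⊆ colours k f := by
  rintro _ ⟨p, hp, rfl⟩
  unfold swapPair
  split_ifs with h1 h2
  · exact ⟨i + 1, by omega, rfl⟩
  · exact ⟨i, by omega, rfl⟩
  · exact ⟨p, by omega, rfl⟩

theorem isTangle_cup : IsTangle k (cup i :: w) l ↔ i ≤ k ∧ IsTangle (k + 2) w l := by
  simp [IsTangle, Kind.inp, Kind.out]

theorem isTangle_cap : IsTangle k (cap i :: w) l ↔ i + 2 ≤ k ∧ IsTangle (k - 2) w l := by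
  simp [IsTangle, Kind.inp, Kind.out]

theorem isTangle_crossing :
    IsTangle k (crossing b i :: w) l ↔ i + 2 ≤ k ∧ IsTangle k w l := by
  simp only [IsTangle, Kind.inp, Kind.out]
  constructor
  · rintro ⟨h, h'⟩; rw [Nat.sub_add_cancel (by omega)] at h'; exact ⟨h, h'⟩
  · rintro ⟨h, h'⟩; rw [Nat.sub_add_cancel (by omega)]; exact ⟨h, h'⟩

theorem isTangle_nil : IsTangle k [] l ↔ k = l := Iff.rfl

/-- Every strand comes from the bottom or from a cup. -/
theorem Run.colours_subset (h : Run w f g A) (hw : IsTangle k w l) :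
    colours l g ⊆ A ∪ colours k f := by
  induction w generalizing k f A with
  | nil => obtain ⟨rfl, rfl⟩ := h; cases hw; simp
  | cons s w ih =>
    obtain ⟨_ | _ | c, i⟩ := s
    · obtain ⟨e, B, rfl, h⟩ := h
      obtain ⟨hi, hw⟩ := isTangle_cup.1 hw
      intro x hx
      rcases ih h hw hx with hx | hx
      · exact Or.inl (Or.inr hx)
      · rcases colours_insertPair hi e f hx with hx | hx
        · exact Or.inl (Or.inl hx)
        · exact Or.inr hx
    · obtain ⟨-, h⟩ := h
      obtain ⟨hi, hw⟩ := isTangle_cap.1 hw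
      exact (ih h hw).trans (Set.union_subset_union_right _ (colours_deletePair hi f))
    · obtain ⟨hi, hw⟩ := isTangle_crossing.1 hw
      exact (ih (A := A) h hw).trans (Set.union_subset_union_right _ (colours_swapPair hi f))

end

/-- The colours of the first `k` strands in two colourings, paired. -/
def pairing (k : ℕ) (f f' : State) : ZMod 2 := ∑ p ∈ Finset.range k, f p * f' p

theorem sum_range_split (h : ℕ → ZMod 2) {i k : ℕ} (hi : i + 2 ≤ k) :
    ∑ p ∈ Finset.range k, h p =
      ∑ p ∈ Finset.range (k - 2), (if p < i then h p else h (p + 2)) + (h i + h (i + 1)) := by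
  obtain ⟨m, rfl⟩ := Nat.exists_eq_add_of_le hi
  rw [show i + 2 + m - 2 = i + m by omega, Finset.sum_range_add, Finset.sum_range_add h,
    Finset.sum_range_add]
  have h1 : ∑ x ∈ Finset.range i, (if x < i then h x else h (x + 2)) =
      ∑ x ∈ Finset.range i, h x :=
    Finset.sum_congr rfl fun x hx => if_pos (Finset.mem_range.1 hx)
  have h2 : ∑ x ∈ Finset.range m, (if i + x < i then h (i + x) else h (i + x + 2)) =
      ∑ x ∈ Finset.range m, h (i + 2 + x) :=
    Finset.sum_congr rfl fun x _ => by rw [if_neg (by omega)]; congr 1; omega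
  rw [h1, h2]
  simp only [Finset.sum_range_succ, Finset.sum_range_zero, add_zero, zero_add]
  ring

section

variable {k l i : ℕ} {w u v : List Slice} {f g f' g' : State} {A B : Set (ZMod 2)}

theorem pairing_insertPair (h : i ≤ k) (e e' : ZMod 2) :
    pairing (k + 2) (insertPair i e f) (insertPair i e' f') = pairing k f f' := by
  unfold pairing
  rw [sum_range_split _ (i := i) (by omega)]
  have : insertPair i e f i * insertPair i e' f' i +
      insertPair i e f (i + 1) * insertPair i e' f' (i + 1) = 0 := by
    simp [insertPair, CharTwo.add_self_eq_zero]
  rw [this, add_zero]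
  refine Finset.sum_congr rfl fun p _ => ?_
  unfold insertPair
  split_ifs <;> first | rfl | omega

theorem pairing_deletePair (h : i + 2 ≤ k) (hf : f i = f (i + 1)) (hf' : f' i = f' (i + 1)) :
    pairing (k - 2) (deletePair i f) (deletePair i f') = pairing k f f' := by
  unfold pairing
  rw [sum_range_split _ h, hf, hf', CharTwo.add_self_eq_zero, add_zero]
  refine Finset.sum_congr rfl fun p _ => ?_
  unfold deletePair
  split_ifs <;> rfl

theorem pairing_swapPair (h : i + 2 ≤ k) :
    pairing k (swapPair i f) (swapPair i f') = pairing k f f' := by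
  unfold pairing
  rw [sum_range_split _ h, sum_range_split (fun p => f p * f' p) h]
  congr 1
  · refine Finset.sum_congr rfl fun p _ => ?_
    unfold swapPair
    split_ifs <;> first | rfl | omega
  · simp [swapPair, add_comm]

/-- The ends of each arc contribute equal summands to the pairing, which cancel: the boundary
colours of the colourings of a tangle form an isotropic subspace. -/
theorem Run.pairing_eq (h : Run w f g A) (h' : Run w f' g' B) (hw : IsTangle k w l) :
    pairing k f f' = pairing l g g' := by
  induction w generalizing k f f' A B with
  | nil => obtain ⟨rfl, rfl⟩ := h; obtain ⟨rfl, rfl⟩ := h'; cases hw; rfl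
  | cons s w ih =>
    obtain ⟨_ | _ | c, i⟩ := s
    · obtain ⟨e, _, rfl, h⟩ := h
      obtain ⟨e', _, rfl, h'⟩ := h'
      obtain ⟨hi, hw⟩ := isTangle_cup.1 hw
      rw [← ih h h' hw, pairing_insertPair hi]
    · obtain ⟨hf, h⟩ := h
      obtain ⟨hf', h'⟩ := h'
      obtain ⟨hi, hw⟩ := isTangle_cap.1 hw
      rw [← ih h h' hw, pairing_deletePair hi hf hf']
    · obtain ⟨hi, hw⟩ := isTangle_crossing.1 hw
      rw [← ih (f := swapPair i f) (f' := swapPair i f') h h' hw, pairing_swapPair hi]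

theorem insertPair_zero (i : ℕ) : insertPair i 0 (0 : State) = 0 := by
  funext p; simp [insertPair]

theorem deletePair_zero (i : ℕ) : deletePair i (0 : State) = 0 := by
  funext p; simp [deletePair]

theorem swapPair_zero (i : ℕ) : swapPair i (0 : State) = 0 := by
  funext p; simp [swapPair]

/-- The strands of a word can all have the colour zero. -/
theorem run_zero (w : List Slice) :
    ∃ A, Run w 0 0 A ∧ ∀ i, cup i ∈ w → 0 ∈ A := by
  induction w with
  | nil => exact ⟨∅, ⟨rfl, rfl⟩, by simp⟩
  | cons s w ih =>
    obtain ⟨A, hA, hA'⟩ := ih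
    obtain ⟨_ | _ | c, i⟩ := s
    · exact ⟨insert 0 A, ⟨0, A, rfl, by rwa [insertPair_zero]⟩, fun _ _ => Set.mem_insert _ _⟩
    · exact ⟨A, ⟨rfl, by rwa [deletePair_zero]⟩, fun j hj => hA' j (by simpa using hj)⟩
    · refine ⟨A, ?_, fun j hj => hA' j (by simpa using hj)⟩
      change Run w _ _ _
      rwa [swapPair_zero]

/-- A closed word that is not empty begins with a cup. -/
theorem IsTangle.exists_cup (hw : IsTangle 0 w l) (h : w ≠ []) : ∃ i, cup i ∈ w := by
  cases w with
  | nil => exact absurd rfl h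
  | cons s w =>
    obtain ⟨_ | _ | c, i⟩ := s
    · exact ⟨i, by simp⟩
    · have := (isTangle_cap.1 hw).1; omega
    · have := (isTangle_crossing.1 hw).1; omega

end

/-! ### Colourings detect knots -/

/-- A closed word, not empty, in each of whose colourings all cups have the same colour. -/
def IsMonochromatic (w : List Slice) : Prop :=
  IsTangle 0 w 0 ∧ w ≠ [] ∧ ∀ A, Run w 0 0 A → A.Subsingleton

/-- A function on the points of the plane that is constant along the arcs of a word. -/
def Respects (w : List Slice) (c : ℕ × ℕ → ZMod 2) : Prop :=
  ∀ x y, Joined w x y → c x = c y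

theorem Respects.eq_of_eqvGen {w : List Slice} {c : ℕ × ℕ → ZMod 2} (hc : Respects w c)
    {x y : ℕ × ℕ} (h : Relation.EqvGen (Joined w) x y) : c x = c y := by
  induction h with
  | rel x y h => exact hc x y h
  | refl => rfl
  | symm _ _ _ ih => exact ih.symm
  | trans _ _ _ _ _ ih ih' => exact ih.trans ih'

theorem Joined.succ {w : List Slice} {s : Slice} {x y : ℕ × ℕ} (h : Joined w x y) :
    Joined (s :: w) (x.1 + 1, x.2) (y.1 + 1, y.2) := by
  cases h with
  | left t p s' h h' => exact .left (t + 1) p s' (by simpa using h) h'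
  | right t p s' h h' => exact .right (t + 1) p s' (by simpa using h) h'
  | cup t i h => exact .cup (t + 1) i (by simpa using h)
  | cap t i h => exact .cap (t + 1) i (by simpa using h)
  | rising t i b h => exact .rising (t + 1) i b (by simpa using h)
  | falling t i b h => exact .falling (t + 1) i b (by simpa using h)

/-- `(t, p)` is a point of the word `w` with `k` strands at the bottom. -/
def IsPointFrom (k : ℕ) (w : List Slice) (x : ℕ × ℕ) : Prop :=
  x.1 ≤ w.length ∧ ∃ m, IsTangle k (w.take x.1) m ∧ x.2 < m

theorem isPointFrom_zero {k p : ℕ} {w : List Slice} : IsPointFrom k w (0, p) ↔ p < k := by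
  simp [IsPointFrom, isTangle_nil]

theorem isPointFrom_succ {k t p : ℕ} {w : List Slice} {s : Slice} :
    IsPointFrom k (s :: w) (t + 1, p) ↔
      s.pos + s.kind.inp ≤ k ∧ IsPointFrom (k - s.kind.inp + s.kind.out) w (t, p) := by
  simp only [IsPointFrom, List.length_cons, List.take_succ_cons, IsTangle, add_le_add_iff_right]
  tauto

theorem isPoint_iff {w : List Slice} (hw : IsTangle 0 w 0) {x : ℕ × ℕ} :
    IsPoint w x ↔ IsPointFrom 0 w x := by
  refine ⟨fun ⟨k, hk, hx⟩ => ⟨?_, k, hk, hx⟩, fun h => h.2⟩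
  by_contra! h
  rw [List.take_of_length_le h.le] at hk
  have := hk.unique hw
  omega

theorem Respects.exists_run {k l : ℕ} {w : List Slice} {c : ℕ × ℕ → ZMod 2} (hc : Respects w c)
    (hw : IsTangle k w l) :
    ∃ g A, Run w (fun p => c (0, p)) g A ∧
      ∀ x, IsPointFrom k w x → c x ∈ A ∪ colours k fun p => c (0, p) := by
  induction w generalizing k c with
  | nil =>
    refine ⟨_, ∅, ⟨rfl, rfl⟩, ?_⟩
    rintro ⟨t, p⟩ h
    obtain rfl : t = 0 := by simpa using h.1
    exact Or.inr ⟨p, isPointFrom_zero.1 h, rfl⟩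
  | cons s w ih =>
    have hc' : Respects w fun x => c (x.1 + 1, x.2) := fun x y h => hc _ _ h.succ
    obtain ⟨g, A, hA, hA'⟩ := ih hc' hw.2
    have hl : ∀ p < s.pos, c (0, p) = c (1, p) := fun p hp => hc _ _ (.left 0 p s rfl hp)
    have hr : ∀ p ≥ s.pos, c (0, p + s.kind.inp) = c (1, p + s.kind.out) :=
      fun p hp => hc _ _ (.right 0 p s rfl hp)
    have key : ∀ B, A ⊆ B → (colours (k - s.kind.inp + s.kind.out) fun p => c (1, p)) ⊆
        B ∪ (colours k fun p => c (0, p)) → ∀ x, IsPointFrom k (s :: w) x →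
        c x ∈ B ∪ colours k fun p => c (0, p) := by
      rintro B hB hcol ⟨_ | t, p⟩ hx
      · exact Or.inr ⟨p, isPointFrom_zero.1 hx, rfl⟩
      · rcases hA' (t, p) (isPointFrom_succ.1 hx).2 with h | h
        · exact Or.inl (hB h)
        · exact hcol h
    obtain ⟨_ | _ | b, i⟩ := s <;> simp only [Kind.inp, Kind.out, add_zero] at hl hr key
    · have hi := (isTangle_cup.1 hw).1
      have h0 : c (1, i) = c (1, i + 1) := hc _ _ (.cup 0 i rfl)
      have h1 : (fun p => c (1, p)) = insertPair i (c (1, i)) fun p => c (0, p) := by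
        funext p
        unfold insertPair
        split_ifs with h2 h3
        · exact (hl p h2).symm
        · obtain rfl | rfl : p = i ∨ p = i + 1 := by omega
          · rfl
          · exact h0.symm
        · have := hr (p - 2) (by omega)
          rw [Nat.sub_add_cancel (by omega)] at this
          exact this.symm
      refine ⟨g, insert (c (1, i)) A, ⟨_, A, rfl, by rw [← h1]; exact hA⟩,
        key _ (Set.subset_insert _ _) ?_⟩
      rw [h1]
      refine (colours_insertPair hi _ _).trans ?_
      rw [Set.insert_union]
      exact Set.insert_subset_insert Set.subset_union_right
    · have hi := (isTangle_cap.1 hw).1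
      have h1 : (fun p => c (1, p)) = deletePair i fun p => c (0, p) := by
        funext p
        unfold deletePair
        split_ifs with h2
        · exact (hl p h2).symm
        · exact (hr p (by omega)).symm
      refine ⟨g, A, ⟨hc _ _ (.cap 0 i rfl), by rw [← h1]; exact hA⟩, key _ subset_rfl ?_⟩
      rw [h1]
      exact (colours_deletePair hi _).trans Set.subset_union_right
    · have hi := (isTangle_crossing.1 hw).1
      have h1 : (fun p => c (1, p)) = swapPair i fun p => c (0, p) := by
        funext p
        unfold swapPair
        split_ifs with h2 h3
        · subst h2; exact (hc _ _ (.falling 0 _ b rfl)).symm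
        · subst h3; exact (hc _ _ (.rising 0 _ b rfl)).symm
        · rcases Nat.lt_or_ge p i with h | h
          · exact (hl p h).symm
          · have := hr (p - 2) (by omega)
            rw [Nat.sub_add_cancel (by omega)] at this
            exact this.symm
      refine ⟨g, A, ?_, key _ subset_rfl ?_⟩
      · change Run w _ _ _
        rw [← h1]; exact hA
      · rw [h1, Nat.sub_add_cancel (by omega)]
        exact (colours_swapPair hi _).trans Set.subset_union_right

theorem Run.exists_respects {k l : ℕ} {w : List Slice} {f g : State} {A : Set (ZMod 2)}
    (h : Run w f g A) (hw : IsTangle k w l) :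
    ∃ c, Respects w c ∧ (∀ p, c (0, p) = f p) ∧ ∀ a ∈ A, ∃ x, IsPointFrom k w x ∧ c x = a := by
  induction w generalizing k f A with
  | nil =>
    obtain ⟨rfl, rfl⟩ := h
    refine ⟨fun x => f x.2, fun x y h => ?_, fun _ => rfl, by simp⟩
    cases h <;> simp_all
  | cons s w ih =>
    -- The colouring of the slices above the first one is shifted up by one.
    have key : ∀ f' B, Run w f' g B → (∀ p < s.pos, f p = f' p) →
        (∀ p ≥ s.pos, f (p + s.kind.inp) = f' (p + s.kind.out)) →
        (s.kind = .cup → f' s.pos = f' (s.pos + 1)) → (s.kind = .cap → f s.pos = f (s.pos + 1)) →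
        (∀ b, s.kind = .crossing b → f s.pos = f' (s.pos + 1) ∧ f (s.pos + 1) = f' s.pos) →
        ∃ c, Respects (s :: w) c ∧ (∀ p, c (0, p) = f p) ∧ (∀ p, c (1, p) = f' p) ∧
          ∀ a ∈ B, ∃ x, IsPointFrom k (s :: w) x ∧ c x = a := by
      intro f' B hB hl hr hcup hcap hcr
      obtain ⟨c, hc, hc0, hcA⟩ := ih hB hw.2
      refine ⟨fun x => if x.1 = 0 then f x.2 else c (x.1 - 1, x.2), ?_, fun p => rfl,
        fun p => hc0 p, ?_⟩
      · intro x y h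
        cases h with
        | left t p s' h h' =>
          rcases t with _ | t
          · obtain rfl : s = s' := by simpa using h
            simpa [hc0] using hl p h'
          · simpa using hc _ _ (.left t p s' (by simpa using h) h')
        | right t p s' h h' =>
          rcases t with _ | t
          · obtain rfl : s = s' := by simpa using h
            simpa [hc0] using hr p h'
          · simpa using hc _ _ (.right t p s' (by simpa using h) h')
        | cup t i h =>
          rcases t with _ | t
          · obtain rfl : s = cup i := by simpa using h
            simpa [hc0] using hcup rfl
          · simpa using hc _ _ (.cup t i (by simpa using h))
        | cap t i h =>
          rcases t with _ | t
          · obtain rfl : s = cap i := by simpa using h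
            simpa [hc0] using hcap rfl
          · simpa using hc _ _ (.cap t i (by simpa using h))
        | rising t i b h =>
          rcases t with _ | t
          · obtain rfl : s = crossing b i := by simpa using h
            simpa [hc0] using (hcr b rfl).1
          · simpa using hc _ _ (.rising t i b (by simpa using h))
        | falling t i b h =>
          rcases t with _ | t
          · obtain rfl : s = crossing b i := by simpa using h
            simpa [hc0] using (hcr b rfl).2
          · simpa using hc _ _ (.falling t i b (by simpa using h))
      · intro a ha
        obtain ⟨⟨t, p⟩, hx, rfl⟩ := hcA a ha
        exact ⟨(t + 1, p), isPointFrom_succ.2 ⟨hw.1, hx⟩, by simp⟩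
    obtain ⟨_ | _ | b, i⟩ := s
    · obtain ⟨e, B, rfl, h⟩ := h
      obtain ⟨c, hc, h0, h1, hA⟩ := key _ B h
        (fun p hp => (insertPair_of_lt hp).symm) (fun p hp => (insertPair_add_two hp).symm)
        (fun _ => by simp [insertPair]) (fun h => by simp at h) (fun b h => by simp at h)
      refine ⟨c, hc, h0, fun a ha => ?_⟩
      obtain rfl | ha := ha
      · refine ⟨(1, i), isPointFrom_succ.2 ⟨hw.1, isPointFrom_zero.2 ?_⟩, ?_⟩
        · have := (isTangle_cup.1 hw).1
          simp only [Kind.inp, Kind.out]; omega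
        · rw [h1]; simp [insertPair]
      · exact hA a ha
    · obtain ⟨hi, h⟩ := h
      obtain ⟨c, hc, h0, -, hA⟩ := key _ A h
        (fun p hp => (deletePair_of_lt hp).symm) (fun p hp => (deletePair_of_le hp).symm)
        (fun h => by simp at h) (fun _ => hi) (fun b h => by simp at h)
      exact ⟨c, hc, h0, hA⟩
    · obtain ⟨c, hc, h0, -, hA⟩ := key (swapPair i f) A h
        (fun p hp => (swapPair_of_lt hp).symm)
        (fun p hp => (swapPair_of_le (Nat.add_le_add_right hp 2)).symm)
        (fun h => by simp at h) (fun h => by simp at h) (fun b _ => by simp [swapPair])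
      exact ⟨c, hc, h0, hA⟩

/-- The colours of the first `k` strands, continued by zero. -/
def truncate (k : ℕ) (f : State) : State := fun p => if p < k then f p else 0

theorem Run.truncate {k l : ℕ} {w : List Slice} {f g : State} {A : Set (ZMod 2)}
    (h : Run w f g A) (hw : IsTangle k w l) : Run w (truncate k f) (truncate l g) A := by
  induction w generalizing k f A with
  | nil => obtain ⟨rfl, rfl⟩ := h; cases hw; exact ⟨rfl, rfl⟩
  | cons s w ih =>
    obtain ⟨_ | _ | c, i⟩ := s
    · obtain ⟨e, B, rfl, h⟩ := h
      obtain ⟨hi, hw⟩ := isTangle_cup.1 hw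
      refine ⟨e, B, rfl, ?_⟩
      convert ih h hw using 1
      funext p; simp only [insertPair, KnotTheory.truncate]; split_ifs <;> first | rfl | omega
    · obtain ⟨hf, h⟩ := h
      obtain ⟨hi, hw⟩ := isTangle_cap.1 hw
      refine ⟨by simp [KnotTheory.truncate, hf, show i < k by omega, show i + 1 < k by omega], ?_⟩
      convert ih h hw using 1
      funext p; simp only [deletePair, KnotTheory.truncate]; split_ifs <;> first | rfl | omega
    · obtain ⟨hi, hw⟩ := isTangle_crossing.1 hw
      change Run w _ _ _
      convert ih (f := swapPair i f) h hw using 1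
      funext p; simp only [swapPair, KnotTheory.truncate]; split_ifs <;> first | rfl | omega

theorem truncate_zero (f : State) : truncate 0 f = 0 := by
  funext p; simp [truncate]

/-- A diagram is connected if and only if its colourings are constant. -/
theorem isKnotDiagram_iff {w : List Slice} : IsKnotDiagram w ↔ IsMonochromatic w := by
  classical
  constructor
  · rintro ⟨hw, hne, hconn⟩
    refine ⟨hw, hne, fun A hA a ha a' ha' => ?_⟩
    obtain ⟨c, hc, -, hcA⟩ := hA.exists_respects hw
    obtain ⟨x, hx, rfl⟩ := hcA a ha
    obtain ⟨y, hy, rfl⟩ := hcA a' ha'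
    exact hc.eq_of_eqvGen (hconn x y ((isPoint_iff hw).2 hx) ((isPoint_iff hw).2 hy))
  · rintro ⟨hw, hne, hmono⟩
    refine ⟨hw, hne, fun x y hx hy => ?_⟩
    -- The colouring that singles out the component of `x`.
    let c : ℕ × ℕ → ZMod 2 := fun z => if Relation.EqvGen (Joined w) x z then 1 else 0
    have hc : Respects w c := fun z z' h => by
      have : Relation.EqvGen (Joined w) x z ↔ Relation.EqvGen (Joined w) x z' :=
        ⟨fun h' => h'.trans _ _ _ (.rel _ _ h), fun h' => h'.trans _ _ _ (.symm _ _ (.rel _ _ h))⟩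
      simp [c, this]
    obtain ⟨g, A, hA, hA'⟩ := hc.exists_run hw
    have hA0 := hA.truncate hw
    rw [truncate_zero, truncate_zero] at hA0
    have h0 : ∀ z, IsPoint w z → c z ∈ A := fun z hz => by
      rcases hA' z ((isPoint_iff hw).1 hz) with h | ⟨p, hp, -⟩
      · exact h
      · omega
    have hxy : c x = c y := hmono A hA0 (h0 x hx) (h0 y hy)
    by_contra hn
    simp [c, hn, Relation.EqvGen.refl] at hxy

/-! ### Isotopic words represent the same knot -/

section

variable {i j : ℕ} {d e : ZMod 2} {f : State}

theorem insertPair_insertPair (h : i ≤ j) :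
    insertPair (j + 2) d (insertPair i e f) = insertPair i e (insertPair j d f) := by
  funext p; simp only [insertPair]; split_ifs <;> first | rfl | omega

theorem deletePair_insertPair (h : i ≤ j) :
    deletePair (j + 2) (insertPair i e f) = insertPair i e (deletePair j f) := by
  funext p; simp only [insertPair, deletePair]
  split_ifs <;> first | rfl | omega | (congr 1; omega)

theorem swapPair_insertPair (h : i ≤ j) :
    swapPair (j + 2) (insertPair i e f) = insertPair i e (swapPair j f) := by
  funext p; simp only [insertPair, swapPair]
  split_ifs <;> first | rfl | omega

theorem insertPair_deletePair (h : i ≤ j) :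
    insertPair j e (deletePair i f) = deletePair i (insertPair (j + 2) e f) := by
  funext p; simp only [insertPair, deletePair]
  split_ifs <;> first | rfl | omega | (congr 1; omega)

theorem deletePair_deletePair (h : i ≤ j) :
    deletePair j (deletePair i f) = deletePair i (deletePair (j + 2) f) := by
  funext p; simp only [deletePair]
  split_ifs <;> first | rfl | omega

theorem swapPair_deletePair (h : i ≤ j) :
    swapPair j (deletePair i f) = deletePair i (swapPair (j + 2) f) := by
  funext p; simp only [deletePair, swapPair]
  split_ifs <;> first | rfl | omega

theorem insertPair_swapPair (h : i ≤ j) :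
    insertPair (j + 2) e (swapPair i f) = swapPair i (insertPair (j + 2) e f) := by
  funext p; simp only [insertPair, swapPair]
  split_ifs <;> first | rfl | omega

theorem deletePair_swapPair (h : i ≤ j) :
    deletePair (j + 2) (swapPair i f) = swapPair i (deletePair (j + 2) f) := by
  funext p; simp only [deletePair, swapPair]
  split_ifs <;> first | rfl | omega

theorem swapPair_swapPair (h : i ≤ j) :
    swapPair (j + 2) (swapPair i f) = swapPair i (swapPair (j + 2) f) := by
  funext p; simp only [swapPair]
  split_ifs <;> first | rfl | omega

end

theorem run_exchange (a b : Kind) {i j : ℕ} (h : i ≤ j) (f g : State) (A : Set (ZMod 2)) :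
    Run [⟨a, i⟩, ⟨b, j + a.out⟩] f g A ↔ Run [⟨b, j + a.inp⟩, ⟨a, i⟩] f g A := by
  have hi : i < j + 2 := by omega
  have hi' : i + 1 < j + 2 := by omega
  obtain _ | _ | a := a <;> obtain _ | _ | b := b <;>
    simp only [Run, Kind.inp, Kind.out, add_zero]
  · constructor
    · rintro ⟨e, _, rfl, d, _, rfl, rfl, rfl⟩
      exact ⟨d, _, Set.insert_comm _ _ _, e, _, rfl, (insertPair_insertPair h).symm, rfl⟩
    · rintro ⟨d, _, rfl, e, _, rfl, rfl, rfl⟩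
      exact ⟨e, _, Set.insert_comm _ _ _, d, _, rfl, insertPair_insertPair h, rfl⟩
  · simp only [deletePair_insertPair h, insertPair_add_two h,
      show j + 2 + 1 = j + 1 + 2 by omega, insertPair_add_two (show i ≤ j + 1 by omega)]
    constructor
    · rintro ⟨e, B, rfl, hf, rfl, rfl⟩; exact ⟨hf, e, _, rfl, rfl, rfl⟩
    · rintro ⟨hf, e, B, rfl, rfl, rfl⟩; exact ⟨e, _, rfl, hf, rfl, rfl⟩
  · simp only [swapPair_insertPair h]
  · simp only [insertPair_deletePair h, insertPair_of_lt hi, insertPair_of_lt hi']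
    constructor
    · rintro ⟨hf, e, B, rfl, rfl, rfl⟩; exact ⟨e, _, rfl, hf, rfl, rfl⟩
    · rintro ⟨e, B, rfl, hf, rfl, rfl⟩; exact ⟨hf, e, _, rfl, rfl, rfl⟩
  · simp only [deletePair_deletePair h, deletePair_of_lt hi, deletePair_of_lt hi',
      deletePair_of_le h, deletePair_of_le (show i ≤ j + 1 by omega)]
    rw [and_left_comm, show j + 1 + 2 = j + 2 + 1 by omega]
  · simp only [swapPair_deletePair h, swapPair_of_lt hi, swapPair_of_lt hi']
  · simp only [insertPair_swapPair h]
  · simp only [deletePair_swapPair h, swapPair_of_le (show i + 2 ≤ j + 2 by omega),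
      swapPair_of_le (show i + 2 ≤ j + 2 + 1 by omega)]
  · simp only [swapPair_swapPair h]

theorem BasicMove.run_iff {k l : ℕ} {a b : List Slice} (h : BasicMove a b) (ha : IsTangle k a l)
    (hb : IsTangle k b l) (f g : State) :
    (∀ A, Run a f g A → ∃ A', Run b f g A' ∧ A ⊆ A' ∪ colours k f) ∧
      ∀ A, Run b f g A → ∃ A', Run a f g A' ∧ A ⊆ A' ∪ colours k f := by
  -- Apart from the cancellation of a minimum and a maximum the two sides have the same cups.
  have same (h : ∀ A, Run a f g A ↔ Run b f g A) :
      (∀ A, Run a f g A → ∃ A', Run b f g A' ∧ A ⊆ A' ∪ colours k f) ∧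
        ∀ A, Run b f g A → ∃ A', Run a f g A' ∧ A ⊆ A' ∪ colours k f :=
    ⟨fun A hA => ⟨A, (h A).1 hA, Set.subset_union_left⟩,
      fun A hA => ⟨A, (h A).2 hA, Set.subset_union_left⟩⟩
  cases h with
  | exchange a b i j h => exact same (run_exchange a b h f g)
  | zigzag_left i =>
    have hd : ∀ e, deletePair (i + 1) (insertPair i e f) = fun p => if p = i then e else f p := by
      intro e
      funext p; simp only [deletePair, insertPair]
      split_ifs <;> first | rfl | omega
    have he : ∀ e, insertPair i e f (i + 1 + 1) = f i := fun e => insertPair_add_two le_rfl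
    have hf : (fun p => if p = i then f i else f p) = f := by
      funext p; split_ifs with h
      · rw [h]
      · rfl
    have hi := (isTangle_cap.1 (isTangle_cup.1 ha).2).1
    simp only [Run, hd, he, insertPair_right]
    constructor
    · rintro _ ⟨e, _, rfl, rfl, rfl, rfl⟩
      exact ⟨∅, ⟨hf.symm, rfl⟩, by rintro x (rfl | ⟨⟨⟩⟩); exact Or.inr ⟨i, by omega, rfl⟩⟩
    · rintro _ ⟨rfl, rfl⟩
      exact ⟨_, ⟨f i, _, rfl, rfl, hf, rfl⟩, by simp⟩
  | zigzag_right i =>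
    have hd : ∀ e, deletePair i (insertPair (i + 1) e f) =
        fun p => if p = i then e else f p := by
      intro e
      funext p; simp only [deletePair, insertPair]
      split_ifs <;> first | rfl | omega
    have he : ∀ e, insertPair (i + 1) e f i = f i := fun e => insertPair_of_lt (by omega)
    have hf : (fun p => if p = i then f i else f p) = f := by
      funext p; split_ifs with h
      · rw [h]
      · rfl
    have hi := (isTangle_cup.1 ha).1
    simp only [Run, hd, he, insertPair_left]
    constructor
    · rintro _ ⟨e, _, rfl, rfl, rfl, rfl⟩
      exact ⟨∅, ⟨hf.symm, rfl⟩, by rintro x (rfl | ⟨⟨⟩⟩); exact Or.inr ⟨i, by omega, rfl⟩⟩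
    · rintro _ ⟨rfl, rfl⟩
      exact ⟨_, ⟨f i, _, rfl, rfl, hf, rfl⟩, by simp⟩
  | cup_crossing b i =>
    refine same fun A => ?_
    have hs : ∀ e, swapPair (i + 1) (insertPair i e f) = swapPair i (insertPair (i + 1) e f) := by
      intro e; funext p; simp only [swapPair, insertPair]
      split_ifs <;> first | rfl | omega
    simp only [Run, hs]
  | crossing_cap b i =>
    refine same fun A => ?_
    have hs : deletePair i (swapPair (i + 1) f) = deletePair (i + 1) (swapPair i f) := by
      funext p; simp only [swapPair, deletePair]
      split_ifs <;> first | rfl | omega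
    simp only [Run, hs, swapPair_left, swapPair_right, swapPair_of_lt (show i < i + 1 by omega),
      swapPair_of_le (show i + 2 ≤ i + 1 + 1 by omega)]
  | reidemeister1_cup b i =>
    refine same fun A => ?_
    have hs : ∀ e, swapPair i (insertPair i e f) = insertPair i e f := by
      intro e; funext p; simp only [swapPair, insertPair]
      split_ifs <;> first | rfl | omega
    simp only [Run, hs]
  | reidemeister1_cap b i =>
    refine same fun A => ?_
    have hs : deletePair i (swapPair i f) = deletePair i f := by
      funext p; simp only [swapPair, deletePair]
      split_ifs <;> first | rfl | omega
    simp only [Run, hs, swapPair_left, swapPair_right, eq_comm (a := f (i + 1))]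
  | reidemeister2 b i =>
    refine same fun A => ?_
    have hs : swapPair i (swapPair i f) = f := by
      funext p; simp only [swapPair]
      split_ifs <;> first | rfl | omega | (congr 1; omega)
    simp only [Run, hs]
  | reidemeister3 b i =>
    refine same fun A => ?_
    have hs : swapPair i (swapPair (i + 1) (swapPair i f)) =
        swapPair (i + 1) (swapPair i (swapPair (i + 1) f)) := by
      funext p; simp only [swapPair]
      split_ifs <;> first | rfl | omega
    simp only [Run, hs]

theorem BasicMove.top_eq {k l l' : ℕ} {a b : List Slice} (h : BasicMove a b)
    (ha : IsTangle k a l) (hb : IsTangle k b l') : l = l' := by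
  cases h with
  | exchange a b i j h =>
    obtain _ | _ | a := a <;> obtain _ | _ | b := b <;>
      simp only [IsTangle, Kind.inp, Kind.out] at ha hb <;> omega
  | _ => simp only [IsTangle, Kind.inp, Kind.out] at ha hb; omega

theorem Run.of_context {u a b v : List Slice} {k : ℕ} (hu : IsTangle 0 u k)
    (hab : ∀ f g A, Run a f g A → ∃ A', Run b f g A' ∧ A ⊆ A' ∪ colours k f) {A : Set (ZMod 2)}
    (h : Run (u ++ a ++ v) 0 0 A) : ∃ A', Run (u ++ b ++ v) 0 0 A' ∧ A ⊆ A' := by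
  obtain ⟨g, _, C, rfl, h, hC⟩ := run_append.1 h
  obtain ⟨f, B, D, rfl, hB, hD⟩ := run_append.1 h
  obtain ⟨D', hD', hsub⟩ := hab f g D hD
  refine ⟨B ∪ D' ∪ C, run_append.2 ⟨g, _, C, rfl, run_append.2 ⟨f, B, D', rfl, hB, hD'⟩, hC⟩, ?_⟩
  have hf : colours k f ⊆ B := by
    refine (hB.colours_subset hu).trans (Set.union_subset subset_rfl ?_)
    rintro _ ⟨p, hp, -⟩
    omega
  refine Set.union_subset_union_left _ (Set.union_subset Set.subset_union_left ?_)
  exact hsub.trans (Set.union_subset Set.subset_union_right (hf.trans Set.subset_union_left))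

theorem TangleMove.isMonochromatic_iff {w w' : List Slice} (h : TangleMove 0 0 w w') :
    IsMonochromatic w ↔ IsMonochromatic w' := by
  obtain ⟨hw, hw', u, a, b, v, hab, rfl, rfl⟩ := h
  obtain ⟨l, hl, hv⟩ := isTangle_append.1 hw
  obtain ⟨k, hu, ha⟩ := isTangle_append.1 hl
  obtain ⟨l', hl', hv'⟩ := isTangle_append.1 hw'
  obtain ⟨k', hu', hb⟩ := isTangle_append.1 hl'
  obtain rfl := hu.unique hu'
  obtain rfl := hab.top_eq ha hb
  -- The word `[]` cannot be reached, since the basic moves with an empty side need strands.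
  have hne : u ++ a ++ v ≠ [] ↔ u ++ b ++ v ≠ [] := by
    rcases u with _ | ⟨s, u⟩
    · cases hu
      cases hab <;> simp [IsTangle, Kind.inp, Kind.out] at ha hb ⊢
    · simp
  constructor
  · rintro ⟨-, h, hm⟩
    refine ⟨hw', hne.1 h, fun A hA => ?_⟩
    obtain ⟨A', hA', hsub⟩ := hA.of_context hu fun f g => (hab.run_iff ha hb f g).2
    exact (hm A' hA').anti hsub
  · rintro ⟨-, h, hm⟩
    refine ⟨hw, hne.2 h, fun A hA => ?_⟩
    obtain ⟨A', hA', hsub⟩ := hA.of_context hu fun f g => (hab.run_iff ha hb f g).1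
    exact (hm A' hA').anti hsub

theorem Isotopic.isMonochromatic_iff {w w' : List Slice} (h : Isotopic 0 0 w w') :
    IsMonochromatic w ↔ IsMonochromatic w' := by
  induction h with
  | rel _ _ h => exact h.isMonochromatic_iff
  | refl => rfl
  | symm _ _ _ ih => exact ih.symm
  | trans _ _ _ _ _ ih ih' => exact ih.trans ih'

/-- The knot with the diagram `w`. -/
def knotOf (w : List Slice) (h : IsMonochromatic w) : Knot :=
  KnotDiagram.knot ⟨w, isKnotDiagram_iff.2 h⟩

theorem exists_knotOf (K : Knot) : ∃ w h, K = knotOf w h := by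
  obtain ⟨⟨w, h⟩, rfl⟩ := Quot.exists_rep K
  exact ⟨w, isKnotDiagram_iff.1 h, rfl⟩

theorem Isotopic.knotOf_eq {w w' : List Slice} (h : Isotopic 0 0 w w') (hw : IsMonochromatic w)
    (hw' : IsMonochromatic w') : knotOf w hw = knotOf w' hw' := by
  induction h with
  | rel _ _ h =>
    obtain ⟨-, -, u, a, b, v, hab, rfl, rfl⟩ := h
    exact Quot.sound ⟨u, a, b, v, hab, rfl, rfl⟩
  | refl => rfl
  | symm _ _ _ ih => exact (ih hw' hw).symm
  | trans w₁ w₂ w₃ h _ ih ih' =>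
    have h₂ := (Isotopic.isMonochromatic_iff h).1 hw
    exact (ih hw h₂).trans (ih' h₂ hw')

/-! ### Isotopies of small tangles -/

theorem Isotopic.of_move {k l : ℕ} {w w' : List Slice} (u a b v : List Slice) (h : BasicMove a b)
    (hw : w = u ++ a ++ v) (hw' : w' = u ++ b ++ v) (t : IsTangle k w l) (t' : IsTangle k w' l) :
    Isotopic k l w w' :=
  .rel _ _ ⟨t, t', u, a, b, v, h, hw, hw'⟩

section

variable {k l i j : ℕ}

theorem isotopic_crossing_cap (b : Bool) (h : i + 3 ≤ k) :
    Isotopic k (k - 2) [crossing b (i + 1), cap i] [crossing (!b) i, cap (i + 1)] := by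
  refine .of_move [] _ _ [] (.crossing_cap b i) rfl rfl ?_ ?_ <;>
    (simp only [IsTangle, Kind.inp, Kind.out]; omega)

theorem isotopic_crossing_cap_same (b : Bool) (h : i + 2 ≤ k) :
    Isotopic k (k - 2) [crossing b i, cap i] [cap i] := by
  refine .of_move [] _ _ [] (.reidemeister1_cap b i) rfl rfl ?_ ?_ <;>
    (simp only [IsTangle, Kind.inp, Kind.out]; omega)

theorem isotopic_cup_cap_left (h : i + 1 ≤ k) : Isotopic k k [cup i, cap (i + 1)] [] := by
  refine .of_move [] _ _ [] (.zigzag_left i) rfl rfl ?_ ?_ <;>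
    (simp only [IsTangle, Kind.inp, Kind.out]; try omega)

theorem isotopic_cup_cap_right (h : i + 1 ≤ k) : Isotopic k k [cup (i + 1), cap i] [] := by
  refine .of_move [] _ _ [] (.zigzag_right i) rfl rfl ?_ ?_ <;>
    (simp only [IsTangle, Kind.inp, Kind.out]; try omega)

theorem isotopic_cap_cap (hij : i ≤ j) (h : j + 4 ≤ k) :
    Isotopic k (k - 4) [cap (j + 2), cap i] [cap i, cap j] := by
  refine .symm (.of_move [] _ _ [] (.exchange .cap .cap i j hij) rfl rfl ?_ ?_) <;>
    (simp only [IsTangle, Kind.inp, Kind.out]; omega)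

theorem isotopic_cup_cap_of_le (hij : i ≤ j) (h : j ≤ k - 2) (hk : i + 2 ≤ k) :
    Isotopic k k [cup (j + 2), cap i] [cap i, cup j] := by
  refine .symm (.of_move [] _ _ [] (.exchange .cap .cup i j hij) rfl rfl ?_ ?_) <;>
    (simp only [IsTangle, Kind.inp, Kind.out]; omega)

theorem isotopic_cup_cap_of_ge (hij : i ≤ j) (h : j + 2 ≤ k) :
    Isotopic k k [cup i, cap (j + 2)] [cap j, cup i] := by
  refine .of_move [] _ _ [] (.exchange .cup .cap i j hij) rfl rfl ?_ ?_ <;>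
    (simp only [IsTangle, Kind.inp, Kind.out]; omega)

theorem isotopic_cup_crossing (b : Bool) (hij : i + 2 ≤ j) (h : j ≤ k) :
    Isotopic k (k + 2) [cup j, crossing b i] [crossing b i, cup j] := by
  obtain ⟨j, rfl⟩ := Nat.exists_eq_add_of_le' hij
  rw [← add_assoc] at *
  refine .symm (.of_move [] _ _ [] (.exchange (.crossing b) .cup i (j + i) (by omega)) rfl rfl
    ?_ ?_) <;>
    (simp only [IsTangle, Kind.inp, Kind.out]; omega)

theorem isotopic_crossing_cap_of_le (b : Bool) (hij : i ≤ j) (h : j + 4 ≤ k) :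
    Isotopic k (k - 2) [crossing b (j + 2), cap i] [cap i, crossing b j] := by
  refine .symm (.of_move [] _ _ [] (.exchange .cap (.crossing b) i j hij) rfl rfl
    ?_ ?_) <;>
    (simp only [IsTangle, Kind.inp, Kind.out]; omega)

end

/-- A crossing, with its upper ends bent down. -/
theorem isotopic_crossing_bent {k i : ℕ} (b : Bool) (h : i + 2 ≤ k) :
    Isotopic k k [crossing b i]
      [cup (i + 2), cup (i + 3), crossing (!b) (i + 1), cap i, cap i] := by
  have h1 : Isotopic k k [cup (i + 2), cup (i + 3), crossing (!b) (i + 1), cap i, cap i]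
      [cup (i + 2), cup (i + 3), crossing b i, cap (i + 1), cap i] := by
    have := (isotopic_crossing_cap (k := k + 4) (i := i) (!b) (by omega)).context (j := k) (m := k)
      (u := [cup (i + 2), cup (i + 3)]) (v := [cap i]) ?_ ?_
    · simpa using this
    all_goals simp only [IsTangle, Kind.inp, Kind.out]; omega
  have h2 : Isotopic k k [cup (i + 2), cup (i + 3), crossing b i, cap (i + 1), cap i]
      [cup (i + 2), crossing b i, cup (i + 3), cap (i + 1), cap i] := by
    refine (isotopic_cup_crossing (k := k + 2) (i := i) (j := i + 3) b (by omega)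
      (by omega)).context (u := [cup (i + 2)]) (v := [cap (i + 1), cap i]) ?_ ?_ <;>
    (simp only [IsTangle, Kind.inp, Kind.out]; omega)
  have h3 : Isotopic k k [cup (i + 2), crossing b i, cup (i + 3), cap (i + 1), cap i]
      [crossing b i, cup (i + 2), cup (i + 3), cap (i + 1), cap i] := by
    refine (isotopic_cup_crossing (k := k) (i := i) (j := i + 2) b (by omega)
      (by omega)).context (u := []) (v := [cup (i + 3), cap (i + 1), cap i]) ?_ ?_ <;>
    (simp only [IsTangle, Kind.inp, Kind.out]; try omega)
  have h4 : Isotopic k k [crossing b i, cup (i + 2), cup (i + 3), cap (i + 1), cap i]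
      [crossing b i, cup (i + 2), cap (i + 1), cup (i + 1), cap i] := by
    refine (isotopic_cup_cap_of_le (k := k + 2) (i := i + 1) (j := i + 1) le_rfl (by omega)
      (by omega)).context (u := [crossing b i, cup (i + 2)]) (v := [cap i]) ?_ ?_ <;>
    (simp only [IsTangle, Kind.inp, Kind.out]; omega)
  have h5 : Isotopic k k [crossing b i, cup (i + 2), cap (i + 1), cup (i + 1), cap i]
      [crossing b i, cup (i + 1), cap i] := by
    refine (isotopic_cup_cap_right (k := k) (i := i + 1)
      (by omega)).context (u := [crossing b i]) (v := [cup (i + 1), cap i]) ?_ ?_ <;>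
    (simp only [IsTangle, Kind.inp, Kind.out]; omega)
  have h6 : Isotopic k k [crossing b i, cup (i + 1), cap i] [crossing b i] := by
    refine (isotopic_cup_cap_right (k := k) (i := i)
      (by omega)).context (u := [crossing b i]) (v := []) ?_ ?_ <;>
    (simp only [IsTangle, Kind.inp, Kind.out]; try omega)
  exact (h1.trans (h2.trans (h3.trans (h4.trans (h5.trans h6))))).symm

/-! ### Colourings of the two patterns -/

/-- The pattern that joins the ends `e₁e₂, e₃e₄, …, e₂ₙ₋₁e₂ₙ`, where `e₁` is the strand `i`. -/
def parallelCaps (n i : ℕ) : List Slice := List.replicate n (cap i)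

/-- The pattern that joins the ends `e₂e₃, …, e₂ₙ₋₂e₂ₙ₋₁, e₂ₙe₁`, where `e₁` is the strand `i`. -/
def shiftedCaps (n i : ℕ) : List Slice := List.replicate (n - 1) (cap (i + 1)) ++ [cap i]

theorem parallelCaps_succ (n i : ℕ) : parallelCaps (n + 1) i = cap i :: parallelCaps n i := rfl

theorem shiftedCaps_succ (n i : ℕ) : shiftedCaps (n + 1) i = parallelCaps n (i + 1) ++ [cap i] :=
  rfl

theorem isTangle_parallelCaps {n i k l : ℕ} (h : i + 2 * n ≤ k) :
    IsTangle k (parallelCaps n i) l ↔ l + 2 * n = k := by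
  induction n generalizing k with
  | zero => simp [parallelCaps, isTangle_nil, eq_comm]
  | succ n ih => rw [parallelCaps_succ, isTangle_cap, ih (by omega)]; omega

theorem isTangle_shiftedCaps {n i k l : ℕ} (hn : 1 ≤ n) (h : i + 2 * n ≤ k) :
    IsTangle k (shiftedCaps n i) l ↔ l + 2 * n = k := by
  obtain ⟨n, rfl⟩ := Nat.exists_eq_add_of_le' hn
  rw [shiftedCaps_succ, isTangle_append]
  constructor
  · rintro ⟨m, h1, h2⟩
    rw [isTangle_parallelCaps (by omega)] at h1
    rw [isTangle_cap, isTangle_nil] at h2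
    omega
  · intro h'
    refine ⟨k - 2 * n, (isTangle_parallelCaps (by omega)).2 (by omega), ?_⟩
    rw [isTangle_cap, isTangle_nil]
    omega

/-- The `2 * n` strands from the position `i` on are dropped. -/
def deleteBlock (i n : ℕ) (f : State) : State := fun p => if p < i then f p else f (p + 2 * n)

theorem deleteBlock_deletePair {i j n : ℕ} (hij : i ≤ j) (hj : j ≤ i + 2 * n) (f : State) :
    deleteBlock i n (deletePair j f) = deleteBlock i (n + 1) f := by
  funext p; simp only [deleteBlock, deletePair]
  split_ifs <;> first | rfl | omega

theorem deletePair_deleteBlock {i n : ℕ} (f : State) :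
    deletePair i (deleteBlock (i + 1) n f) = deleteBlock i (n + 1) f := by
  funext p; simp only [deleteBlock, deletePair]
  split_ifs <;> first | rfl | omega | (congr 1; omega)

theorem deleteBlock_swapPair {i j n : ℕ} (hij : i ≤ j) (hj : j + 2 ≤ i + 2 * n) (f : State) :
    deleteBlock i n (swapPair j f) = deleteBlock i n f := by
  funext p; simp only [deleteBlock, swapPair]
  split_ifs <;> first | rfl | omega

section

variable {n i j : ℕ} {f g : State} {A : Set (ZMod 2)}

theorem run_parallelCaps : Run (parallelCaps n i) f g A ↔
    A = ∅ ∧ g = deleteBlock i n f ∧ ∀ m < n, f (i + 2 * m) = f (i + 2 * m + 1) := by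
  induction n generalizing f with
  | zero =>
    have : deleteBlock i 0 f = f := by funext p; simp [deleteBlock]
    simp [parallelCaps, this, and_comm, eq_comm]
  | succ n ih =>
    rw [parallelCaps_succ, run_cap, ih, deleteBlock_deletePair le_rfl (by omega)]
    have : (∀ m < n + 1, f (i + 2 * m) = f (i + 2 * m + 1)) ↔ f i = f (i + 1) ∧
        ∀ m < n, deletePair i f (i + 2 * m) = deletePair i f (i + 2 * m + 1) := by
      constructor
      · intro h
        refine ⟨h 0 (by omega), fun m hm => ?_⟩
        rw [deletePair_of_le (by omega), deletePair_of_le (by omega)]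
        exact h (m + 1) (by omega)
      · rintro ⟨h0, h⟩ (_ | m) hm
        · exact h0
        · have := h m (by omega)
          rw [deletePair_of_le (by omega), deletePair_of_le (by omega)] at this
          exact this
    rw [this]
    tauto

theorem run_shiftedCaps : Run (shiftedCaps (n + 1) i) f g A ↔
    A = ∅ ∧ g = deleteBlock i (n + 1) f ∧ f i = f (i + 2 * n + 1) ∧
      ∀ m < n, f (i + 2 * m + 1) = f (i + 2 * m + 2) := by
  have e : ∀ m, i + 1 + 2 * m = i + 2 * m + 1 := fun m => by omega
  rw [shiftedCaps_succ, run_append]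
  simp only [run_parallelCaps, run_cap, run_nil, e]
  have h1 : deleteBlock (i + 1) n f i = f i := if_pos (by omega)
  have h2 : deleteBlock (i + 1) n f (i + 1) = f (i + 2 * n + 1) := by
    rw [← e]; exact if_neg (by omega)
  constructor
  · rintro ⟨h, B, C, rfl, ⟨rfl, rfl, h3⟩, h4, rfl, rfl⟩
    rw [h1, h2] at h4
    exact ⟨by simp, deletePair_deleteBlock f, h4, h3⟩
  · rintro ⟨rfl, rfl, h4, h3⟩
    exact ⟨_, ∅, ∅, by simp, ⟨rfl, rfl, h3⟩, by rwa [h1, h2], deletePair_deleteBlock f, rfl⟩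

/-- The colourings of the pattern that results from `parallelCaps (n + 2) i` by the surgery on the
arcs number `j` and `j + 1`. -/
theorem run_cap_parallelCaps (hj : j ≤ n) :
    Run (cap (i + 2 * j + 1) :: parallelCaps (n + 1) i) f g A →
    A = ∅ ∧ g = deleteBlock i (n + 2) f ∧ f (i + 2 * j + 1) = f (i + 2 * j + 2) ∧
      f (i + 2 * j) = f (i + 2 * j + 3) ∧
      ∀ m < n + 2, m ≠ j → m ≠ j + 1 → f (i + 2 * m) = f (i + 2 * m + 1) := by
  rw [run_cap, run_parallelCaps, deleteBlock_deletePair (by omega) (by omega)]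
  rintro ⟨h1, rfl, rfl, h⟩
  refine ⟨rfl, rfl, h1, ?_, fun m hm hmj hmj' => ?_⟩
  · have := h j (by omega)
    rwa [deletePair_of_lt (by omega), deletePair_of_le (by omega)] at this
  · rcases Nat.lt_or_ge m j with h' | h'
    · have := h m (by omega)
      rwa [deletePair_of_lt (by omega), deletePair_of_lt (by omega)] at this
    · obtain ⟨m, rfl⟩ := Nat.exists_eq_add_of_le' (show 1 ≤ m by omega)
      have := h m (by omega)
      rwa [deletePair_of_le (by omega), deletePair_of_le (by omega)] at this

end

theorem pairing_deleteBlock {i n k : ℕ} (h : i + 2 * n ≤ k) (f f' : State) :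
    pairing k f f' = pairing (k - 2 * n) (deleteBlock i n f) (deleteBlock i n f') +
      ∑ m ∈ Finset.range n, (f (i + 2 * m) * f' (i + 2 * m) +
        f (i + 2 * m + 1) * f' (i + 2 * m + 1)) := by
  induction n generalizing k f f' with
  | zero =>
    have : ∀ f, deleteBlock i 0 f = f := fun f => by funext p; simp [deleteBlock]
    simp [this]
  | succ n ih =>
    have h0 : pairing k f f' = pairing (k - 2) (deletePair i f) (deletePair i f') +
        (f i * f' i + f (i + 1) * f' (i + 1)) := by
      unfold pairing
      rw [sum_range_split _ (show i + 2 ≤ k by omega)]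
      congr 1
      refine Finset.sum_congr rfl fun p _ => ?_
      unfold deletePair
      split_ifs <;> rfl
    rw [h0, ih (by omega), deleteBlock_deletePair le_rfl (by omega),
      deleteBlock_deletePair le_rfl (by omega), Finset.sum_range_succ', add_assoc,
      show k - 2 - 2 * n = k - 2 * (n + 1) by omega]
    congr 2
    refine Finset.sum_congr rfl fun m _ => ?_
    rw [deletePair_of_le (by omega), deletePair_of_le (by omega), deletePair_of_le (by omega),
      deletePair_of_le (by omega)]
    rfl

/-! ### Colourings of the outside of a pattern -/

/-- `f` is the restriction to the `k` strands below a hole between `u` and `v` of a colouring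
of the outside of the hole. The hole meets the diagram in `2 * n` strands from `i` on, and `A` is
the set of the colours of the cups outside. -/
def OutsideRun (u v : List Slice) (i n : ℕ) (f : State) (A : Set (ZMod 2)) : Prop :=
  ∃ B C, A = B ∪ C ∧ Run u 0 f B ∧ Run v (deleteBlock i n f) 0 C

section

variable {u v a : List Slice} {i n k : ℕ} {f f' g : State} {A B : Set (ZMod 2)}

/-- The outside of the hole is a tangle with `2 * n` ends, so its colourings are isotropic. -/
theorem OutsideRun.sum_eq_zero (hu : IsTangle 0 u k) (hv : IsTangle (k - 2 * n) v 0)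
    (hk : i + 2 * n ≤ k) (h : OutsideRun u v i n f A) (h' : OutsideRun u v i n f' B) :
    ∑ m ∈ Finset.range n, (f (i + 2 * m) * f' (i + 2 * m) +
        f (i + 2 * m + 1) * f' (i + 2 * m + 1)) = 0 := by
  obtain ⟨_, _, -, h1, h2⟩ := h
  obtain ⟨_, _, -, h1', h2'⟩ := h'
  have hp := pairing_deleteBlock hk f f'
  rw [← h1.pairing_eq h1' hu, h2.pairing_eq h2' hv] at hp
  simpa [pairing] using hp.symm

theorem OutsideRun.run (h : OutsideRun u v i n f A) (ha : Run a f (deleteBlock i n f) ∅) :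
    Run (u ++ a ++ v) 0 0 A := by
  obtain ⟨B, C, rfl, h1, h2⟩ := h
  exact run_append.2 ⟨_, B, C, rfl, run_append.2 ⟨f, B, ∅, by simp, h1, ha⟩, h2⟩

/-- A diagram that is not a knot has a colouring with two colours. -/
theorem exists_outsideRun (hw : IsTangle 0 (u ++ a ++ v) 0) (hne : a ≠ [])
    (ha : ∀ f g A, Run a f g A → A = ∅ ∧ g = deleteBlock i n f)
    (h : ¬ IsMonochromatic (u ++ a ++ v)) :
    ∃ f A, OutsideRun u v i n f A ∧ Run a f (deleteBlock i n f) ∅ ∧ ¬ A.Subsingleton := by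
  unfold IsMonochromatic at h
  push Not at h
  obtain ⟨A, hA, hA'⟩ := h hw (by simp [hne])
  obtain ⟨g, _, C, rfl, h1, hC⟩ := run_append.1 hA
  obtain ⟨f, B, D, rfl, hB, hD⟩ := run_append.1 h1
  obtain ⟨rfl, rfl⟩ := ha _ _ _ hD
  exact ⟨f, _, ⟨B, C, rfl, hB, hC⟩, hD, by simpa using hA'⟩

end

/-! ### Which surgeries give a knot -/

/-- An arc whose ends have equal colours in both colourings does not contribute to the pairing. -/
theorem arc_pairing_eq_zero {a b c d : ZMod 2} (h : a = b) (h' : c = d) : a * c + b * d = 0 := by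
  rw [h, h', CharTwo.add_self_eq_zero]

/-- The three ways to join four ends: the colourings `e` of the outside with `e₁e₂, e₃e₄` glued and
those with `e₂e₃, e₄e₁` glued cannot both be nonconstant. -/
theorem four_ends : ∀ a b c d a' b' c' d' : ZMod 2,
    a * a' + b * b' + (c * c' + d * d') = 0 → a = b → c = d → b' = c' → d' = a' →
      a = c ∨ a' = b' := by
  decide

theorem sum_range_of_eq_zero {r n : ℕ} (hn : r ≤ n) (h : ℕ → ZMod 2)
    (h0 : ∀ m < n, r ≤ m → h m = 0) : ∑ m ∈ Finset.range n, h m = ∑ m ∈ Finset.range r, h m := by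
  refine (Finset.sum_subset (Finset.range_mono hn) fun m hm hm' => ?_).symm
  simp only [Finset.mem_range] at hm hm'
  exact h0 m hm (by omega)

theorem sum_range_four {n j : ℕ} (hj : 2 ≤ j) (hn : j + 2 ≤ n) (h : ℕ → ZMod 2)
    (h0 : ∀ m < n, 2 ≤ m → m ≠ j → m ≠ j + 1 → h m = 0) :
    ∑ m ∈ Finset.range n, h m = h 0 + h 1 + h j + h (j + 1) := by
  rw [← Finset.sum_subset (s₁ := {0, 1, j, j + 1})]
  · rw [Finset.sum_insert, Finset.sum_insert, Finset.sum_insert, Finset.sum_singleton]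
    · ring
    all_goals
      simp only [Finset.mem_insert, Finset.mem_singleton]
      omega
  · intro m hm
    simp only [Finset.mem_insert, Finset.mem_singleton] at hm
    simp only [Finset.mem_range]
    omega
  · intro m hm hm'
    simp only [Finset.mem_insert, Finset.mem_singleton, Finset.mem_range] at hm hm'
    exact h0 m hm (by omega) (by omega) (by omega)

section

variable {u v : List Slice} {i k n : ℕ}

/-- If four ends can be joined crosswise so that a knot results, then one of the two ways
to join them without a crossing gives a knot as well. -/
theorem IsMonochromatic.smoothing {b : Bool} (hu : IsTangle 0 u k) (hv : IsTangle (k - 4) v 0)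
    (hk : i + 4 ≤ k)
    (h : IsMonochromatic (u ++ crossing b (i + 1) :: parallelCaps 2 i ++ v)) :
    IsMonochromatic (u ++ parallelCaps 2 i ++ v) ∨ IsMonochromatic (u ++ shiftedCaps 2 i ++ v) := by
  by_contra! hn
  obtain ⟨h1, h2⟩ := hn
  have t1 : IsTangle k (parallelCaps 2 i) (k - 4) := (isTangle_parallelCaps (by omega)).2 (by omega)
  have t2 : IsTangle k (shiftedCaps 2 i) (k - 4) :=
    (isTangle_shiftedCaps (by omega) (by omega)).2 (by omega)
  obtain ⟨f, A, hf, hfr, hA⟩ := exists_outsideRun (i := i) (n := 2) ((hu.append t1).append hv)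
    (by simp [parallelCaps]) (fun f g A h => by
      obtain ⟨h, h', -⟩ := run_parallelCaps.1 h; exact ⟨h, h'⟩) h1
  obtain ⟨f', A', hf', hfr', hA'⟩ := exists_outsideRun (i := i) (n := 2) ((hu.append t2).append hv)
    (by simp [shiftedCaps]) (fun f g A h => by
      obtain ⟨h, h', -⟩ := (run_shiftedCaps (n := 1)).1 h; exact ⟨h, h'⟩) h2
  obtain ⟨-, -, hp⟩ := run_parallelCaps.1 hfr
  obtain ⟨-, -, hq, hq'⟩ := (run_shiftedCaps (n := 1)).1 hfr'
  have p0 : f i = f (i + 1) := hp 0 (by omega)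
  have p1 : f (i + 2) = f (i + 3) := hp 1 (by omega)
  have q0 : f' (i + 1) = f' (i + 2) := hq' 0 (by omega)
  have q1 : f' (i + 3) = f' i := hq.symm
  -- A colouring with the same colour at all four ends is a colouring of the knot.
  have key : ∀ (f : State) (A : Set (ZMod 2)), OutsideRun u v i 2 f A → f i = f (i + 1) →
      f i = f (i + 2) → f i = f (i + 3) → A.Subsingleton := by
    intro f A hf e1 e2 e3
    refine h.2.2 A (hf.run ?_)
    rw [run_crossing, run_parallelCaps, deleteBlock_swapPair (by omega) (by omega)]
    refine ⟨rfl, rfl, fun m hm => ?_⟩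
    obtain rfl | rfl : m = 0 ∨ m = 1 := by omega
    · rw [swapPair_of_lt (by omega), mul_zero, add_zero, swapPair_left]; exact e2
    · rw [swapPair_of_le (p := i + 2 * 1 + 1) (by omega)]
      exact (swapPair_right (i := i + 1)).trans (e1.symm.trans e3)
  have hs := hf.sum_eq_zero hu hv hk hf'
  simp only [Finset.sum_range_succ, Finset.sum_range_zero, zero_add, mul_zero, add_zero] at hs
  rcases four_ends _ _ _ _ _ _ _ _ hs p0 p1 q0 q1 with e | e
  · exact hA (key f A hf p0 e (e.trans p1))
  · exact hA' (key f' A' hf' e (e.trans q0) q1.symm)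

end

/-- The colours at three arcs, of which the first two are subject to one surgery in the colouring
`x, y, y, x, z, z` and the last two to another one in `s, s, p, q, q, p`, while in
`a, b, a, c, c, b` the ends of the first two arcs are crossed as well. -/
theorem six_ends : ∀ x y z s p q a b c : ZMod 2, x ≠ y → z ≠ x → p ≠ q →
    (x * s + y * s) + (y * p + x * q) + (z * q + z * p) = 0 →
    (x * a + y * b) + (y * a + x * c) + (z * c + z * b) = 0 →
    (s * a + s * b) + (p * a + q * c) + (q * c + p * b) = 0 → a = b ∧ a = c := by
  decide

/-- The analogue of `six_ends` for two surgeries that involve four different arcs. -/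
theorem eight_ends : ∀ x y z s t p q a b c d : ZMod 2, x ≠ y → z ≠ x → p ≠ q →
    (x * s + y * s) + (y * t + x * t) + (x * p + x * q) + (z * q + z * p) = 0 →
    (x * a + y * b) + (y * a + x * b) + (x * c + x * d) + (z * d + z * c) = 0 →
    (s * a + s * b) + (t * a + t * b) + (p * c + q * d) + (q * d + p * c) = 0 →
      a = b ∧ c = d := by
  decide

/-- The step of `exists_surgery` for two surgeries with a common arc: `e` and `e''` are the colours
of the ends in colourings for the surgery on the first two arcs and on the second and third arc,
respectively, and `e'` in one for the latter surgery after a crossing of the ends `e' 1` and `e' 2`.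
By isotropy `e'` is a colouring of `parallelCaps`. -/
theorem surgery_six_ends {n : ℕ} (hn : 3 ≤ n) {e e' e'' : ℕ → ZMod 2}
    (sum1 : ∑ m ∈ Finset.range n, (e (2 * m) * e'' (2 * m) + e (2 * m + 1) * e'' (2 * m + 1)) = 0)
    (sum2 : ∑ m ∈ Finset.range n, (e (2 * m) * e' (2 * m) + e (2 * m + 1) * e' (2 * m + 1)) = 0)
    (sum3 : ∑ m ∈ Finset.range n,
      (e'' (2 * m) * e' (2 * m) + e'' (2 * m + 1) * e' (2 * m + 1)) = 0)
    (h12 : e 1 = e 2) (h03 : e 0 = e 3) (h45 : e 4 = e 5) (hxy : e 0 ≠ e 1) (hz : e 4 ≠ e 0)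
    (h01'' : e'' 0 = e'' 1) (h34'' : e'' 3 = e'' 4) (h25'' : e'' 2 = e'' 5) (hpq : e'' 2 ≠ e'' 3)
    (h02' : e' 0 = e' 2) (h34' : e' 3 = e' 4) (h15' : e' 1 = e' 5)
    (he : ∀ m < n, 3 ≤ m → e (2 * m) = e (2 * m + 1))
    (he'' : ∀ m < n, 3 ≤ m → e'' (2 * m) = e'' (2 * m + 1))
    (he' : ∀ m < n, 3 ≤ m → e' (2 * m) = e' (2 * m + 1)) :
    ∀ m < n, e' (2 * m) = e' (2 * m + 1) := by
  rw [sum_range_of_eq_zero hn _ fun m hm h => arc_pairing_eq_zero (he m hm h) (he'' m hm h)] at sum1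
  rw [sum_range_of_eq_zero hn _ fun m hm h => arc_pairing_eq_zero (he m hm h) (he' m hm h)] at sum2
  rw [sum_range_of_eq_zero hn _ fun m hm h =>
    arc_pairing_eq_zero (he'' m hm h) (he' m hm h)] at sum3
  norm_num [Finset.sum_range_succ] at sum1 sum2 sum3
  rw [← h12, ← h03, ← h45, ← h01'', ← h34'', ← h25''] at sum1
  rw [← h12, ← h03, ← h45, ← h02', ← h34', ← h15'] at sum2
  rw [← h01'', ← h34'', ← h25'', ← h02', ← h34', ← h15'] at sum3
  obtain ⟨h1, h2⟩ := six_ends _ _ _ _ _ _ _ _ _ hxy hz hpq sum1 sum2 sum3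
  intro m hm
  obtain rfl | rfl | rfl | h : m = 0 ∨ m = 1 ∨ m = 2 ∨ 3 ≤ m := by omega
  · exact h1
  · exact h02'.symm.trans h2
  · exact h34'.symm.trans (h2.symm.trans (h1.trans h15'))
  · exact he' m hm h

/-- The analogue of `surgery_six_ends` for surgeries on the first two arcs and on the arcs number
`j` and `j + 1`. -/
theorem surgery_eight_ends {n j : ℕ} (hj : 2 ≤ j) (hn : j + 2 ≤ n) {e e' e'' : ℕ → ZMod 2}
    (sum1 : ∑ m ∈ Finset.range n, (e (2 * m) * e'' (2 * m) + e (2 * m + 1) * e'' (2 * m + 1)) = 0)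
    (sum2 : ∑ m ∈ Finset.range n, (e (2 * m) * e' (2 * m) + e (2 * m + 1) * e' (2 * m + 1)) = 0)
    (sum3 : ∑ m ∈ Finset.range n,
      (e'' (2 * m) * e' (2 * m) + e'' (2 * m + 1) * e' (2 * m + 1)) = 0)
    (h12 : e 1 = e 2) (h03 : e 0 = e 3) (hxy : e 0 ≠ e 1)
    (hx : e (2 * j + 1) = e 0) (hz : e (2 * j + 2) ≠ e 0)
    (h01'' : e'' 0 = e'' 1) (h23'' : e'' 2 = e'' 3) (hj'' : e'' (2 * j + 1) = e'' (2 * j + 2))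
    (hj3'' : e'' (2 * j) = e'' (2 * j + 3)) (hpq : e'' (2 * j) ≠ e'' (2 * j + 1))
    (h02' : e' 0 = e' 2) (h13' : e' 1 = e' 3) (hj' : e' (2 * j + 1) = e' (2 * j + 2))
    (hj3' : e' (2 * j) = e' (2 * j + 3))
    (he : ∀ m < n, 2 ≤ m → e (2 * m) = e (2 * m + 1))
    (he'' : ∀ m < n, 2 ≤ m → m ≠ j → m ≠ j + 1 → e'' (2 * m) = e'' (2 * m + 1))
    (he' : ∀ m < n, 2 ≤ m → m ≠ j → m ≠ j + 1 → e' (2 * m) = e' (2 * m + 1)) :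
    ∀ m < n, e' (2 * m) = e' (2 * m + 1) := by
  rw [sum_range_four hj hn _ fun m hm h h1 h2 =>
    arc_pairing_eq_zero (he m hm h) (he'' m hm h h1 h2)] at sum1
  rw [sum_range_four hj hn _ fun m hm h h1 h2 =>
    arc_pairing_eq_zero (he m hm h) (he' m hm h h1 h2)] at sum2
  rw [sum_range_four hj hn _ fun m hm h h1 h2 =>
    arc_pairing_eq_zero (he'' m hm h h1 h2) (he' m hm h h1 h2)] at sum3
  simp only [mul_add, mul_zero, zero_add, mul_one, add_assoc, Nat.reduceAdd] at sum1 sum2 sum3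
  have ej : e (2 * j) = e 0 := (he j (by omega) hj).trans hx
  have ej3 : e (2 * j + 2) = e (2 * j + 3) := he (j + 1) (by omega) (by omega)
  rw [← h12, ← h03, ej, hx, ← ej3, ← h01'', ← h23'', ← hj'', ← hj3''] at sum1
  rw [← h12, ← h03, ej, hx, ← ej3, ← h02', ← h13', ← hj', ← hj3'] at sum2
  rw [← h01'', ← h23'', ← hj'', ← hj3'', ← h02', ← h13', ← hj', ← hj3'] at sum3
  simp only [← add_assoc] at sum1 sum2 sum3
  obtain ⟨h1, h2⟩ := eight_ends _ _ _ (e'' 0) (e'' 2) _ _ (e' 0) (e' 1) (e' (2 * j))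
    (e' (2 * j + 1)) hxy hz hpq
    (by linear_combination sum1) (by linear_combination sum2) (by linear_combination sum3)
  intro m hm
  by_cases hmj : m = j
  · rw [hmj]; exact h2
  by_cases hmj' : m = j + 1
  · rw [hmj']; exact hj'.symm.trans (h2.symm.trans hj3')
  obtain rfl | rfl | h : m = 0 ∨ m = 1 ∨ 2 ≤ m := by omega
  · exact h1
  · exact h02'.symm.trans (h1.trans h13')
  · exact he' m hm h hmj hmj'

section

variable {u v : List Slice} {i k n : ℕ}

/-- If the two patterns of an `H(n)`-move complete the outside to a knot, then so does a pattern
that results from `parallelCaps` by a surgery on two neighbouring arcs, possibly after the ends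
`e₂` and `e₃` have been crossed. -/
theorem exists_surgery (hu : IsTangle 0 u k) (hv : IsTangle (k - 2 * (n + 2)) v 0)
    (hk : i + 2 * (n + 2) ≤ k) (h₁ : IsMonochromatic (u ++ parallelCaps (n + 2) i ++ v))
    (h₂ : IsMonochromatic (u ++ shiftedCaps (n + 2) i ++ v)) :
    (∃ j ≤ n, IsMonochromatic (u ++ cap (i + 2 * j + 1) :: parallelCaps (n + 1) i ++ v)) ∨
    ∃ j ≤ n, 1 ≤ j ∧ ∀ b,
      IsMonochromatic (u ++ crossing b (i + 1) :: parallelCaps (n + 2) i ++ v) ∧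
      IsMonochromatic (u ++ crossing b (i + 1) :: cap (i + 2 * j + 1) :: parallelCaps (n + 1) i
        ++ v) := by
  by_contra! hn
  obtain ⟨hn₁, hn₂⟩ := hn
  have tQ : ∀ j ≤ n, IsTangle k (cap (i + 2 * j + 1) :: parallelCaps (n + 1) i)
      (k - 2 * (n + 2)) := fun j hj => by
    rw [isTangle_cap, isTangle_parallelCaps (by omega)]; omega
  have hQ : ∀ j ≤ n, ∃ f A, OutsideRun u v i (n + 2) f A ∧
      Run (cap (i + 2 * j + 1) :: parallelCaps (n + 1) i) f (deleteBlock i (n + 2) f) ∅ ∧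
      ¬ A.Subsingleton := fun j hj =>
    exists_outsideRun ((hu.append (tQ j hj)).append hv) (by simp)
      (fun f g A h => by
        obtain ⟨h, h', -⟩ := run_cap_parallelCaps hj h; exact ⟨h, h'⟩) (hn₁ j hj)
  have key : ∀ f A, OutsideRun u v i (n + 2) f A → ¬ A.Subsingleton →
      ¬ ∀ m < n + 2, f (i + 2 * m) = f (i + 2 * m + 1) := fun f A hf hA h =>
    hA (h₁.2.2 A (hf.run (run_parallelCaps.2 ⟨rfl, rfl, h⟩)))
  obtain ⟨f, A, hf, hfr, hA⟩ := hQ 0 (by omega)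
  obtain ⟨-, -, h12, h03, hpair⟩ := run_cap_parallelCaps (Nat.zero_le n) hfr
  have hxy : f i ≠ f (i + 1) := fun h => key f A hf hA fun m hm => by
    obtain rfl | rfl | h' : m = 0 ∨ m = 1 ∨ 2 ≤ m := by omega
    · exact h
    · exact h12.symm.trans (h.symm.trans h03)
    · exact hpair m hm (by omega) (by omega)
  -- The first arc after the second one whose colour differs from that of `e₁`.
  have hex : ∃ m, 2 ≤ m ∧ m < n + 2 ∧ f (i + 2 * m) ≠ f i := by
    by_contra! hall
    refine hA (h₂.2.2 A (hf.run (run_shiftedCaps.2 ⟨rfl, rfl, ?_, fun m hm => ?_⟩)))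
    · rcases Nat.eq_zero_or_pos n with rfl | h0
      · exact h03
      · exact (hall (n + 1) (by omega) (by omega)).symm.trans
          (hpair (n + 1) (by omega) (by omega) (by omega))
    · obtain rfl | h0 : m = 0 ∨ 1 ≤ m := by omega
      · exact h12
      · refine Eq.trans ?_ (hall (m + 1) (by omega) (by omega)).symm
        obtain rfl | h0 : m = 1 ∨ 2 ≤ m := by omega
        · exact h03.symm
        · exact (hpair m (by omega) (by omega) (by omega)).symm.trans (hall m h0 (by omega))
  classical
  obtain ⟨hm2, hmn, hz⟩ := Nat.find_spec hex
  have hmin := fun m => Nat.find_min (H := hex) (m := m)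
  generalize Nat.find hex = m at hm2 hmn hz hmin
  obtain ⟨j, rfl⟩ := Nat.exists_eq_add_of_le' (show 1 ≤ m by omega)
  have hx : f (i + 2 * j + 1) = f i := by
    obtain rfl | h0 : j = 1 ∨ 2 ≤ j := by omega
    · exact h03.symm
    · have : f (i + 2 * j) = f i := by
        by_contra h
        exact hmin j (by omega) ⟨h0, by omega, h⟩
      rw [← this]
      exact (hpair j (by omega) (by omega) (by omega)).symm
  obtain ⟨b, hb⟩ := hn₂ j (by omega) (by omega)
  have hswap : ∀ (f : State) (p : ℕ), 3 ≤ p → swapPair (i + 1) f (i + p) = f (i + p) :=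
    fun f p hp => swapPair_of_le (by omega)
  have hswap0 : ∀ f : State, swapPair (i + 1) f i = f i := fun f => swapPair_of_lt (by omega)
  have hblock : ∀ f, deleteBlock i (n + 2) (swapPair (i + 1) f) = deleteBlock i (n + 2) f :=
    fun f => deleteBlock_swapPair (by omega) (by omega) f
  refine hb ?_ ?_
  · -- A colouring `f'` of the crossed pattern is orthogonal to `f`, so it colours the first pattern.
    by_contra hX
    obtain ⟨f', A', hf', hfr', hA'⟩ := exists_outsideRun (i := i) (n := n + 2)
      ((hu.append (isTangle_crossing.2 ⟨by omega,
        (isTangle_parallelCaps hk).2 (Nat.sub_add_cancel (by omega))⟩)).append hv) (by simp)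
      (fun f g A h => by
        obtain ⟨h, h', -⟩ := run_parallelCaps.1 (run_crossing.1 h)
        exact ⟨h, by rw [h', hblock]⟩) hX
    obtain ⟨-, -, hpair'⟩ := run_parallelCaps.1 (run_crossing.1 hfr')
    have hpair2 : ∀ m < n + 2, 2 ≤ m → f' (i + 2 * m) = f' (i + 2 * m + 1) := fun m hm h => by
      have := hpair' m hm
      rwa [hswap _ _ (by omega), add_assoc, hswap _ _ (by omega)] at this
    have h02' : f' i = f' (i + 2) := by
      have := hpair' 0 (by omega)
      rw [mul_zero, add_zero, hswap0] at this
      exact this.trans swapPair_left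
    have h13' : f' (i + 1) = f' (i + 3) := by
      have := hpair' 1 (by omega)
      rw [add_assoc i, hswap _ (2 * 1 + 1) (by omega)] at this
      exact (swapPair_right (i := i + 1)).symm.trans this
    have hs := hf.sum_eq_zero hu hv hk hf'
    rw [sum_range_of_eq_zero (r := 2) (by omega) _ fun m hm h => arc_pairing_eq_zero
      (hpair m hm (by omega) (by omega)) (hpair2 m hm h)] at hs
    simp only [Finset.sum_range_succ, Finset.sum_range_zero, zero_add, mul_zero, add_zero,
      mul_one] at hs
    have h01' : f' i = f' (i + 1) := by
      have h4 : ∀ x y a b : ZMod 2, x ≠ y → x * a + y * b + (y * a + x * b) = 0 → a = b := by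
        decide
      refine h4 _ _ _ _ hxy ?_
      rw [← hs, ← h13', ← h02']
      have e1 : f (i + 2) = f (i + 1) := h12.symm
      have e2 : f (i + 2 + 1) = f i := h03.symm
      rw [e1, e2]
    refine key f' A' hf' hA' fun m hm => ?_
    obtain rfl | rfl | h : m = 0 ∨ m = 1 ∨ 2 ≤ m := by omega
    · exact h01'
    · exact h02'.symm.trans (h01'.trans h13')
    · exact hpair2 m hm h
  · -- Here `f'` is also orthogonal to a nonconstant colouring `f''` for the surgery at `j`.
    by_contra hX
    obtain ⟨f', A', hf', hfr', hA'⟩ := exists_outsideRun (i := i) (n := n + 2)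
      ((hu.append (isTangle_crossing.2 ⟨by omega, tQ j (by omega)⟩)).append hv) (by simp)
      (fun f g A h => by
        obtain ⟨h, h', -⟩ := run_cap_parallelCaps (by omega) (run_crossing.1 h)
        exact ⟨h, by rw [h', hblock]⟩) hX
    obtain ⟨-, -, hj1', hj0', hpair'⟩ := run_cap_parallelCaps (by omega) (run_crossing.1 hfr')
    obtain ⟨f'', A'', hf'', hfr'', hA''⟩ := hQ j (by omega)
    obtain ⟨-, -, hj1'', hj0'', hpair''⟩ := run_cap_parallelCaps (by omega) hfr''
    refine key f' A' hf' hA' ?_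
    have hpq : f'' (i + 2 * j) ≠ f'' (i + 2 * j + 1) := fun h =>
        key f'' A'' hf'' hA'' fun m hm => by
      by_cases hmj : m = j
      · rw [hmj]; exact h
      by_cases hmj' : m = j + 1
      · rw [hmj']; exact hj1''.symm.trans (h.symm.trans hj0'')
      exact hpair'' m hm hmj hmj'
    have sum1 := hf.sum_eq_zero hu hv hk hf''
    have sum2 := hf.sum_eq_zero hu hv hk hf'
    have sum3 := hf''.sum_eq_zero hu hv hk hf'
    have hpair2 : ∀ m < n + 2, 2 ≤ m → m ≠ j → m ≠ j + 1 → f' (i + 2 * m) = f' (i + 2 * m + 1) :=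
      fun m hm h h1 h2 => by
        have := hpair' m hm h1 h2
        rwa [hswap _ _ (by omega), add_assoc, hswap _ _ (by omega)] at this
    have h02' : f' i = f' (i + 2) := by
      have := hpair' 0 (by omega) (by omega) (by omega)
      rw [mul_zero, add_zero, hswap0] at this
      exact this.trans swapPair_left
    rw [add_assoc i, add_assoc i, hswap _ _ (by omega), hswap _ _ (by omega)] at hj1'
    obtain rfl | h0 : j = 1 ∨ 2 ≤ j := by omega
    · have h15' : f' (i + 1) = f' (i + 5) := by
        rw [add_assoc i, hswap _ (2 * 1 + 3) (by omega)] at hj0'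
        exact (swapPair_right (i := i + 1)).symm.trans hj0'
      exact surgery_six_ends (n := n + 2) (by omega) (e := fun p => f (i + p))
        (e' := fun p => f' (i + p)) (e'' := fun p => f'' (i + p)) sum1 sum2 sum3 h12 h03
        (hpair 2 (by omega) (by omega) (by omega)) hxy hz
        (hpair'' 0 (by omega) (by omega) (by omega)) hj1'' hj0'' hpq h02' hj1' h15'
        (fun m hm h => hpair m hm (by omega) (by omega))
        (fun m hm h => hpair'' m hm (by omega) (by omega))
        (fun m hm h => hpair2 m hm (by omega) (by omega) (by omega))
    · have h13' : f' (i + 1) = f' (i + 3) := by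
        have := hpair' 1 (by omega) (by omega) (by omega)
        rw [add_assoc i, hswap _ (2 * 1 + 1) (by omega)] at this
        exact (swapPair_right (i := i + 1)).symm.trans this
      rw [hswap _ _ (by omega), add_assoc i, hswap _ _ (by omega)] at hj0'
      exact surgery_eight_ends (n := n + 2) h0 (by omega) (e := fun p => f (i + p))
        (e' := fun p => f' (i + p)) (e'' := fun p => f'' (i + p)) sum1 sum2 sum3 h12 h03 hxy hx hz
        (hpair'' 0 (by omega) (by omega) (by omega)) (hpair'' 1 (by omega) (by omega) (by omega))
        hj1'' hj0'' hpq h02' h13' hj1' hj0'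
        (fun m hm h => hpair m hm (by omega) (by omega)) (fun m hm _ => hpair'' m hm) hpair2

end

/-! ### Distances in Gordian graphs -/

/-- Some path of at most `m` edges joins the two vertices. -/
def WithinDist {V : Type*} (G : SimpleGraph V) (m : ℕ) (v w : V) : Prop :=
  ∃ p : G.Walk v w, p.length ≤ m

namespace WithinDist

variable {V : Type*} {G : SimpleGraph V} {m m' : ℕ} {v w x : V}

theorem refl (m : ℕ) (v : V) : WithinDist G m v v := ⟨.nil, by simp⟩

theorem of_eq (m : ℕ) (h : v = w) : WithinDist G m v w := h ▸ refl m v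

theorem symm (h : WithinDist G m v w) : WithinDist G m w v := by
  obtain ⟨p, hp⟩ := h
  exact ⟨p.reverse, by simpa⟩

theorem trans (h : WithinDist G m v w) (h' : WithinDist G m' w x) :
    WithinDist G (m + m') v x := by
  obtain ⟨p, hp⟩ := h
  obtain ⟨q, hq⟩ := h'
  exact ⟨p.append q, by rw [SimpleGraph.Walk.length_append]; omega⟩

theorem mono (h : WithinDist G m v w) (hm : m ≤ m') : WithinDist G m' v w := by
  obtain ⟨p, hp⟩ := h
  exact ⟨p, by omega⟩

end WithinDist

variable {u v w w' : List Slice} {i j k n : ℕ}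

/-- Diagrams that are, up to isotopy, related by an `H(n)`-move. -/
theorem withinDist_one (hw : IsMonochromatic w) (hw' : IsMonochromatic w')
    (h : Isotopic 0 0 w (u ++ parallelCaps n i ++ v))
    (h' : Isotopic 0 0 w' (u ++ shiftedCaps n i ++ v)) :
    WithinDist (gordianGraph n) 1 (knotOf w hw) (knotOf w' hw') := by
  have m := h.isMonochromatic_iff.1 hw
  have m' := h'.isMonochromatic_iff.1 hw'
  rw [h.knotOf_eq hw m, h'.knotOf_eq hw' m']
  by_cases heq : knotOf _ m = knotOf _ m'
  · exact .of_eq _ heq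
  · have hadj : (gordianGraph n).Adj (knotOf _ m) (knotOf _ m') :=
      (SimpleGraph.fromRel_adj _ _ _).2
        ⟨heq, Or.inl ⟨_, _, rfl, rfl, u, _, _, v, .mk i, rfl, rfl⟩⟩
    exact ⟨hadj.toWalk, le_rfl⟩

/-- Any of the parallel caps can be the lowest one. -/
theorem isotopic_parallelCaps (hj : j ≤ n) (hk : i + 2 * (n + 1) ≤ k) :
    Isotopic k (k - 2 * (n + 1)) (parallelCaps (n + 1) i)
      (cap (i + 2 * j) :: parallelCaps n i) := by
  induction j generalizing n k with
  | zero => exact .refl _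
  | succ j ih =>
    obtain ⟨n, rfl⟩ := Nat.exists_eq_add_of_le' (show 1 ≤ n by omega)
    have h1 := (ih (n := n) (k := k - 2) (by omega) (by omega)).below (j := k) [cap i]
      (by rw [isTangle_cap, isTangle_nil]; omega)
    have h2 := (isotopic_cap_cap (k := k) (i := i) (j := i + 2 * j) (by omega)
      (by omega)).symm.above (m := k - 2 * (n + 1 + 1)) (parallelCaps n i)
      ((isTangle_parallelCaps (by omega)).2 (by omega))
    rw [show k - 2 - 2 * (n + 1) = k - 2 * (n + 1 + 1) by omega] at h1
    exact h1.trans h2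

/-- Any of the arcs of `shiftedCaps` except the long one, `e₂ₙe₁`, can be the lowest cap. -/
theorem isotopic_shiftedCaps (hj : j ≤ n) (hk : i + 2 * (n + 2) ≤ k) :
    Isotopic k (k - 2 * (n + 2)) (shiftedCaps (n + 2) i)
      (cap (i + 2 * j + 1) :: shiftedCaps (n + 1) i) := by
  have h := (isotopic_parallelCaps (i := i + 1) (k := k) hj (by omega)).above
    (m := k - 2 * (n + 2)) [cap i] (by rw [isTangle_cap, isTangle_nil]; omega)
  rwa [show i + 1 + 2 * j = i + 2 * j + 1 by omega] at h

/-- Crossing the ends `e₂` and `e₃` does not change the pattern `shiftedCaps`. -/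
theorem isotopic_crossing_shiftedCaps (b : Bool) (hk : i + 2 * (n + 2) ≤ k) :
    Isotopic k (k - 2 * (n + 2)) (crossing b (i + 1) :: shiftedCaps (n + 2) i)
      (shiftedCaps (n + 2) i) := by
  refine (isotopic_crossing_cap_same (k := k) (i := i + 1) b (by omega)).above
    (parallelCaps n (i + 1) ++ [cap i]) ?_
  rw [← shiftedCaps_succ, isTangle_shiftedCaps] <;> omega

/-- The crossing of two arcs can be turned by a right angle. -/
theorem isotopic_crossing_parallelCaps (b : Bool) (hk : i + 4 ≤ k) :
    Isotopic k (k - 4) (crossing b (i + 1) :: parallelCaps 2 i)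
      (crossing (!b) i :: shiftedCaps 2 i) := by
  have h := (isotopic_crossing_cap (k := k) (i := i) b (by omega)).above (m := k - 4) [cap i]
    (by rw [isTangle_cap, isTangle_nil]; omega)
  exact h

/-- A surgery on two neighbouring arcs of `parallelCaps` is an `H(2)`-move. -/
theorem withinDist_surgery (hu : IsTangle 0 u k) (hv : IsTangle (k - 2 * (n + 2)) v 0)
    (hk : i + 2 * (n + 2) ≤ k) (hj : j ≤ n)
    (h : IsMonochromatic (u ++ parallelCaps (n + 2) i ++ v))
    (h' : IsMonochromatic (u ++ cap (i + 2 * j + 1) :: parallelCaps (n + 1) i ++ v)) :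
    WithinDist (gordianGraph 2) 1 (knotOf _ h) (knotOf _ h') := by
  have e : k - 2 - 2 * (n + 1) = k - 2 * (n + 2) := by omega
  have h2 := (isotopic_parallelCaps (i := i) (k := k - 2) hj (by omega))
  rw [e] at h2
  have h3 (p : ℕ) (hp : p + 2 ≤ k) := h2.below (j := k) [cap p]
    (by rw [isTangle_cap, isTangle_nil]; omega)
  have h1 := (isotopic_parallelCaps (n := n + 1) (i := i) (k := k) (j := j) (by omega)
    (by omega)).trans (h3 _ (by omega))
  have hr := (h3 (i + 2 * j + 1) (by omega)).context hu hv
  have hl := h1.context hu hv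
  refine withinDist_one (u := u) (v := parallelCaps n i ++ v) (i := i + 2 * j) h h' ?_ ?_
  · simpa [parallelCaps] using hl
  · simpa [shiftedCaps] using hr

/-- The parallel and the crossed way to join four ends are related by an `H(2)`-move, since the
crossing can be created by a first Reidemeister move on one of the arcs. -/
theorem withinDist_crossing (b : Bool) (hu : IsTangle 0 u k) (hv : IsTangle (k - 4) v 0)
    (hk : i + 4 ≤ k)
    (h : IsMonochromatic (u ++ parallelCaps 2 i ++ v))
    (h' : IsMonochromatic (u ++ crossing b (i + 1) :: parallelCaps 2 i ++ v)) :
    WithinDist (gordianGraph 2) 1 (knotOf _ h) (knotOf _ h') := by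
  have hl := (((isotopic_crossing_cap_same (k := k) (i := i) (!b) (by omega)).above (m := k - 4)
    [cap i] (by rw [isTangle_cap, isTangle_nil]; omega)).symm.context hu hv)
  have hr := (isotopic_crossing_parallelCaps b hk).context hu hv
  refine withinDist_one (u := u ++ [crossing (!b) i]) (v := v) (i := i) h h' ?_ ?_
  · simpa [parallelCaps] using hl
  · simpa using hr

/-- The shifted and the crossed way to join four ends are related by an `H(2)`-move. -/
theorem withinDist_crossing' (b : Bool) (hu : IsTangle 0 u k) (hv : IsTangle (k - 4) v 0)
    (hk : i + 4 ≤ k)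
    (h : IsMonochromatic (u ++ shiftedCaps 2 i ++ v))
    (h' : IsMonochromatic (u ++ crossing b (i + 1) :: parallelCaps 2 i ++ v)) :
    WithinDist (gordianGraph 2) 1 (knotOf _ h') (knotOf _ h) := by
  have hl := (isotopic_crossing_shiftedCaps (n := 0) b hk).symm.context hu hv
  refine withinDist_one (u := u ++ [crossing b (i + 1)]) (v := v) (i := i) h' h ?_ ?_
  · simpa using Isotopic.refl _
  · simpa using hl

/-- An `H(n + 1)`-move is a composition of at most `2 * n` moves `H(2)` through knots. -/
theorem withinDist_of_hMove (hu : IsTangle 0 u k) (hv : IsTangle (k - 2 * (n + 1)) v 0)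
    (hk : i + 2 * (n + 1) ≤ k) (h₁ : IsMonochromatic (u ++ parallelCaps (n + 1) i ++ v))
    (h₂ : IsMonochromatic (u ++ shiftedCaps (n + 1) i ++ v)) :
    WithinDist (gordianGraph 2) (2 * n) (knotOf _ h₁) (knotOf _ h₂) := by
  induction n generalizing u k with
  | zero => exact .refl _ _
  | succ n ih =>
    -- The word below, to which the induction hypothesis applies after a surgery.
    have step : ∀ (u : List Slice), IsTangle 0 u k → ∀ j ≤ n,
        ∀ (h : IsMonochromatic (u ++ cap (i + 2 * j + 1) :: parallelCaps (n + 1) i ++ v))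
        (h' : IsMonochromatic (u ++ shiftedCaps (n + 2) i ++ v)),
        WithinDist (gordianGraph 2) (2 * n) (knotOf _ h) (knotOf _ h') := by
      intro u hu j hj h h'
      have hiso := (isotopic_shiftedCaps hj hk).context hu hv
      have hm := hiso.isMonochromatic_iff.1 h'
      rw [hiso.knotOf_eq h' hm]
      have e1 : u ++ cap (i + 2 * j + 1) :: parallelCaps (n + 1) i ++ v =
          (u ++ [cap (i + 2 * j + 1)]) ++ parallelCaps (n + 1) i ++ v := by simp
      have e2 : u ++ cap (i + 2 * j + 1) :: shiftedCaps (n + 1) i ++ v =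
          (u ++ [cap (i + 2 * j + 1)]) ++ shiftedCaps (n + 1) i ++ v := by simp
      have := ih (u := u ++ [cap (i + 2 * j + 1)]) (k := k - 2)
        (hu.append (by rw [isTangle_cap, isTangle_nil]; omega))
        (by rwa [show k - 2 - 2 * (n + 1) = k - 2 * (n + 1 + 1) by omega]) (by omega)
        (e1 ▸ h) (e2 ▸ hm)
      simpa only [e1, e2] using this
    obtain ⟨j, hj, h⟩ | ⟨j, hj, hj1, h⟩ := exists_surgery hu hv hk h₁ h₂
    · exact ((withinDist_surgery hu hv hk hj h₁ h).trans (step u hu j hj h h₂)).mono (by omega)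
    · obtain ⟨hX, hX'⟩ := h true
      have hiso := (isotopic_crossing_shiftedCaps true hk).symm.context hu hv
      have hm := hiso.isMonochromatic_iff.1 h₂
      rw [hiso.knotOf_eq h₂ hm]
      have d1 : WithinDist (gordianGraph 2) 1 (knotOf _ h₁) (knotOf _ hX) := by
        have e1 : u ++ parallelCaps (n + 2) i ++ v =
          u ++ parallelCaps 2 i ++ (parallelCaps n i ++ v) := by
          simp [parallelCaps, List.replicate_succ]
        have e2 : u ++ crossing true (i + 1) :: parallelCaps (n + 2) i ++ v =
          u ++ crossing true (i + 1) :: parallelCaps 2 i ++ (parallelCaps n i ++ v) := by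
          simp [parallelCaps, List.replicate_succ]
        have := withinDist_crossing true (v := parallelCaps n i ++ v) hu
          (((isTangle_parallelCaps (by omega)).2 (by omega)).append hv) (by omega) (e1 ▸ h₁)
          (e2 ▸ hX)
        simpa only [e1, e2] using this
      have hu' : IsTangle 0 (u ++ [crossing true (i + 1)]) k :=
        hu.append (by rw [isTangle_crossing, isTangle_nil]; omega)
      have e1 : u ++ crossing true (i + 1) :: parallelCaps (n + 2) i ++ v =
          (u ++ [crossing true (i + 1)]) ++ parallelCaps (n + 2) i ++ v := by simp
      have e2 : u ++ crossing true (i + 1) :: cap (i + 2 * j + 1) :: parallelCaps (n + 1) i ++ v =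
          (u ++ [crossing true (i + 1)]) ++ cap (i + 2 * j + 1) :: parallelCaps (n + 1) i ++ v := by
        simp
      have e3 : u ++ crossing true (i + 1) :: shiftedCaps (n + 2) i ++ v =
          (u ++ [crossing true (i + 1)]) ++ shiftedCaps (n + 2) i ++ v := by simp
      have d2 := withinDist_surgery hu' hv hk hj (e1 ▸ hX) (e2 ▸ hX')
      have d3 := step _ hu' j hj (e2 ▸ hX') (e3 ▸ hm)
      have := (d1.trans ((by simpa only [e1, e2] using d2 :
        WithinDist (gordianGraph 2) 1 (knotOf _ hX) (knotOf _ hX')).trans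
        (by simpa only [e2, e3] using d3 :
          WithinDist (gordianGraph 2) (2 * n) (knotOf _ hX') (knotOf _ hm))))
      exact this.mono (by omega)

/-! ### Unknotting by `H(2)`-moves -/

/-- The diagram of the trivial knot without crossings. -/
theorem isMonochromatic_unknot : IsMonochromatic [cup 0, cap 0] := by
  refine ⟨by simp [IsTangle, Kind.inp, Kind.out], by simp, fun A hA => ?_⟩
  obtain ⟨e, B, rfl, -, -, rfl⟩ := hA
  simp

/-- The trivial knot. -/
def unknot : Knot := knotOf _ isMonochromatic_unknot

/-- Number of crossings of a word. -/
def crossingNumber (w : List Slice) : ℕ :=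
  (w.filter fun s => match s.kind with | .crossing _ => true | _ => false).length

theorem crossingNumber_append (u v : List Slice) :
    crossingNumber (u ++ v) = crossingNumber u + crossingNumber v := by
  simp [crossingNumber]

/-- A circle that consists of a cup and the cap right above it is the whole knot diagram. -/
theorem IsMonochromatic.eq_unknot {u v : List Slice} {i : ℕ}
    (h : IsMonochromatic (u ++ [cup i, cap i] ++ v)) : u = [] ∧ v = [] := by
  obtain ⟨k, hk, hv⟩ := isTangle_append.1 h.1
  obtain ⟨B, hB, hB'⟩ := run_zero u
  obtain ⟨C, hC, hC'⟩ := run_zero v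
  have hcirc : Run [cup i, cap i] 0 0 {1} := by
    refine ⟨1, ∅, by simp, by simp, ?_, rfl⟩
    funext p
    simp only [State.deletePair, State.insertPair]
    split_ifs <;> first | rfl | omega
  have hA := h.2.2 _ (run_append.2 ⟨0, _, C, rfl, run_append.2 ⟨0, B, {1}, rfl, hB, hcirc⟩, hC⟩)
  have hu : u = [] := by
    by_contra hne
    obtain ⟨l, hl, -⟩ := isTangle_append.1 hk
    obtain ⟨j, hj⟩ := hl.exists_cup hne
    exact zero_ne_one (hA (Or.inl (Or.inl (hB' j hj))) (Or.inl (Or.inr rfl)))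
  subst hu
  refine ⟨rfl, ?_⟩
  by_contra hne
  obtain rfl : k = 0 := by
    have : i ≤ 0 := (isTangle_cup.1 hk).1
    have := (isTangle_cap.1 (isTangle_cup.1 hk).2).2
    simpa [isTangle_nil] using this.symm
  obtain ⟨j, hj⟩ := hv.exists_cup hne
  exact zero_ne_one (hA (Or.inr (hC' j hj)) (Or.inl (Or.inr rfl)))

/-- The lowest cap of a diagram without crossings can be moved down until it cancels a cup. -/
theorem exists_shorter {u v : List Slice} {i : ℕ} (hcup : ∀ s ∈ u, s.kind = .cup)
    (h : IsMonochromatic (u ++ cap i :: v)) (hne : u ++ cap i :: v ≠ [cup 0, cap 0]) :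
    ∃ w, w.length < (u ++ cap i :: v).length ∧
      crossingNumber w = crossingNumber (u ++ cap i :: v) ∧ Isotopic 0 0 (u ++ cap i :: v) w := by
  induction u using List.reverseRecOn generalizing i v with
  | nil =>
    have := (isTangle_cap.1 h.1).1
    omega
  | append_singleton u s ih =>
    obtain ⟨kind, j⟩ := s
    obtain rfl : kind = .cup := hcup ⟨kind, j⟩ (by simp)
    have hw : u ++ [cup j] ++ cap i :: v = u ++ [cup j, cap i] ++ v := by simp
    rw [hw] at h hne ⊢
    obtain ⟨k, hk, hv⟩ := isTangle_append.1 h.1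
    obtain ⟨l, hu, hl⟩ := isTangle_append.1 hk
    obtain ⟨hjl, hl'⟩ := isTangle_cup.1 hl
    obtain ⟨hil, hl''⟩ := isTangle_cap.1 hl'
    rw [isTangle_nil] at hl''
    obtain rfl : l = k := by omega
    -- If the cap is moved past the cup, the induction hypothesis applies.
    have move : ∀ i' j', Isotopic l l [cup j, cap i] [cap i', cup j'] → ∃ w,
        w.length < (u ++ [cup j, cap i] ++ v).length ∧
        crossingNumber w = crossingNumber (u ++ [cup j, cap i] ++ v) ∧
        Isotopic 0 0 (u ++ [cup j, cap i] ++ v) w := by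
      intro i' j' hiso
      have hiso := hiso.context hu hv
      have e : u ++ [cap i', cup j'] ++ v = u ++ cap i' :: (cup j' :: v) := by simp
      have hm := hiso.isMonochromatic_iff.1 h
      rw [e] at hm hiso
      obtain ⟨w, hw, hw', hw''⟩ := ih (fun s hs => hcup s (by simp [hs])) hm (by
        intro heq
        rcases u with _ | ⟨s, u⟩
        · simp at heq
        · have := congrArg List.length heq
          simp only [List.length_append, List.length_cons, List.length_nil] at this
          omega)
      exact ⟨w, by simpa using hw, by simpa [crossingNumber] using hw', hiso.trans hw''⟩
    have cancel : Isotopic l l [cup j, cap i] [] → ∃ w,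
        w.length < (u ++ [cup j, cap i] ++ v).length ∧
        crossingNumber w = crossingNumber (u ++ [cup j, cap i] ++ v) ∧
        Isotopic 0 0 (u ++ [cup j, cap i] ++ v) w := fun hiso =>
      ⟨u ++ [] ++ v, by simp, by simp [crossingNumber], hiso.context hu hv⟩
    obtain hij | rfl | rfl | rfl | hij : i + 2 ≤ j ∨ j = i + 1 ∨ j = i ∨ i = j + 1 ∨ j + 2 ≤ i := by
      omega
    · obtain ⟨j, rfl⟩ := Nat.exists_eq_add_of_le' hij
      rw [← add_assoc] at *
      exact move i (j + i) (isotopic_cup_cap_of_le (by omega) (by omega) (by omega))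
    · exact cancel (isotopic_cup_cap_right (by omega))
    · obtain ⟨rfl, rfl⟩ := h.eq_unknot
      cases hu
      obtain rfl : j = 0 := by omega
      exact absurd rfl hne
    · exact cancel (isotopic_cup_cap_left (by omega))
    · obtain ⟨i, rfl⟩ := Nat.exists_eq_add_of_le' hij
      rw [← add_assoc] at *
      exact move (i + j) j (isotopic_cup_cap_of_ge (by omega) (by omega))

theorem exists_cap {w : List Slice} {k : ℕ} (hw : IsTangle k w 0) (hk : 0 < k)
    (hc : crossingNumber w = 0) :
    ∃ u i v, w = u ++ cap i :: v ∧ ∀ s ∈ u, s.kind = .cup := by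
  induction w generalizing k with
  | nil => cases hw; omega
  | cons s w ih =>
    obtain ⟨_ | _ | b, i⟩ := s
    · obtain ⟨u, j, v, rfl, hu⟩ := ih (isTangle_cup.1 hw).2 (by omega)
        (by simpa [crossingNumber] using hc)
      exact ⟨cup i :: u, j, v, rfl, by simpa using hu⟩
    · exact ⟨[], i, w, rfl, by simp⟩
    · simp [crossingNumber] at hc

/-- A diagram without crossings represents the trivial knot. -/
theorem knotOf_eq_unknot {w : List Slice} (hw : IsMonochromatic w) (hc : crossingNumber w = 0) :
    knotOf w hw = unknot := by
  induction hl : w.length using Nat.strong_induction_on generalizing w with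
  | _ n ih =>
    by_cases h0 : w = [cup 0, cap 0]
    · subst h0; rfl
    have : ∃ u i v, w = u ++ cap i :: v ∧ ∀ s ∈ u, s.kind = .cup := by
      obtain ⟨ht, hne, -⟩ := hw
      rcases w with _ | ⟨⟨_ | _ | b, i⟩, w⟩
      · exact absurd rfl hne
      · obtain ⟨u, j, v, rfl, hu⟩ := exists_cap (isTangle_cup.1 ht).2 (by omega)
          (by simpa [crossingNumber] using hc)
        exact ⟨cup i :: u, j, v, rfl, by simpa using hu⟩
      · have := (isTangle_cap.1 ht).1; omega
      · have := (isTangle_crossing.1 ht).1; omega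
    obtain ⟨u, i, v, rfl, hu⟩ := this
    obtain ⟨w', hlen, hc', hiso⟩ := exists_shorter hu hw h0
    rw [hiso.knotOf_eq hw (hiso.isMonochromatic_iff.1 hw)]
    exact ih _ (hl ▸ hlen) _ (hc'.trans hc) rfl

/-- Every knot is at most as far from the trivial knot as one of its diagrams has crossings. -/
theorem withinDist_unknot {w : List Slice} (hw : IsMonochromatic w) :
    WithinDist (gordianGraph 2) (crossingNumber w) (knotOf w hw) unknot := by
  induction hc : crossingNumber w generalizing w with
  | zero => exact .of_eq _ (knotOf_eq_unknot hw hc)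
  | succ c ih =>
    obtain ⟨u, b, i, v, rfl⟩ : ∃ u b i v, w = u ++ [crossing b i] ++ v := by
      obtain ⟨s, hs⟩ := List.exists_mem_of_length_pos
        (show 0 < _ from hc.symm ▸ Nat.succ_pos c : 0 < crossingNumber w)
      rw [List.mem_filter] at hs
      obtain ⟨u, v, rfl⟩ := List.append_of_mem hs.1
      obtain ⟨_ | _ | b, i⟩ := s
      · simp at hs
      · simp at hs
      · exact ⟨u, b, i, v, by simp⟩
    obtain ⟨k, hk, hv⟩ := isTangle_append.1 hw.1
    obtain ⟨l, hu, hl⟩ := isTangle_append.1 hk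
    obtain ⟨hil, rfl⟩ := isTangle_crossing.1 hl
    have hiso := (isotopic_crossing_bent b hil).context hu hv
    have hm := hiso.isMonochromatic_iff.1 hw
    rw [hiso.knotOf_eq hw hm]
    set u' := u ++ [cup (i + 2), cup (i + 3)] with hu'
    have tu' : IsTangle 0 u' (l + 4) := hu.append (by
      simp only [IsTangle, Kind.inp, Kind.out]; omega)
    have e : u ++ [cup (i + 2), cup (i + 3), crossing (!b) (i + 1), cap i, cap i] ++ v =
        u' ++ crossing (!b) (i + 1) :: parallelCaps 2 i ++ v := by
      simp [hu', parallelCaps]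
    have hm' := e ▸ hm
    have hcr : ∀ a, crossingNumber a = 0 → crossingNumber (u' ++ a ++ v) = c := by
      intro a ha
      simp only [crossingNumber_append, ha, hu'] at hc ⊢
      simp [crossingNumber] at hc ⊢
      omega
    have hk' : knotOf _ hm = knotOf _ hm' := by simp only [e]
    rw [hk']
    obtain h | h := hm'.smoothing tu' hv (by omega)
    · exact ((withinDist_crossing _ tu' hv (by omega) h hm').symm.trans
        (ih h (hcr _ (by simp [crossingNumber, parallelCaps])))).mono (by omega)
    · exact ((withinDist_crossing' _ tu' hv (by omega) h hm').trans
        (ih h (hcr _ (by simp [crossingNumber, shiftedCaps])))).mono (by omega)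

theorem gordianGraph_two_connected : (gordianGraph 2).Connected := by
  have h : ∀ K, (gordianGraph 2).Reachable K unknot := fun K => by
    obtain ⟨w, hw, rfl⟩ := exists_knotOf K
    obtain ⟨p, -⟩ := withinDist_unknot hw
    exact ⟨p⟩
  exact (SimpleGraph.connected_iff _).2 ⟨fun K K' => (h K).trans (h K').symm, ⟨unknot⟩⟩

/-! ### Comparison of the Gordian graphs -/

section

variable {i j k m n : ℕ}

/-- A strand with a curl in it, to be closed by the caps of an `H(n)`-move: the strand `j` runs to
the position `j + 1`, between the two ends of a cup. -/
def curl (b : Bool) (j : ℕ) : List Slice := [cup (j + 1), crossing b j]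

theorem isotopic_curl_parallelCaps (b : Bool) (hij : i ≤ j) (hk : j + 2 * m + 1 ≤ k) :
    Isotopic k (k + 2 - 2 * m) (curl b (j + 2 * m) ++ parallelCaps m i)
      (parallelCaps m i ++ curl b j) := by
  induction m generalizing k with
  | zero => simpa [parallelCaps] using Isotopic.refl _
  | succ m ih =>
    have t : IsTangle k (parallelCaps m i) (k - 2 * m) :=
      (isTangle_parallelCaps (by omega)).2 (by omega)
    have h1 : Isotopic k k (curl b (j + 2 * m + 2) ++ [cap i]) ([cap i] ++ curl b (j + 2 * m)) := by
      have h1 := (isotopic_crossing_cap_of_le (k := k + 2) (i := i) (j := j + 2 * m) b (by omega)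
        (by omega)).below (j := k) [cup (j + 2 * m + 3)]
        (by rw [isTangle_cup, isTangle_nil]; omega)
      have h2 := (isotopic_cup_cap_of_le (k := k) (i := i) (j := j + 2 * m + 1) (by omega)
        (by omega) (by omega)).above (m := k) [crossing b (j + 2 * m)]
        (by rw [isTangle_crossing, isTangle_nil]; omega)
      exact h1.trans h2
    have h2 := h1.above (m := k + 2 - 2 * (m + 1)) (parallelCaps m i)
      ((isTangle_parallelCaps (by omega)).2 (by omega))
    have h3 := (ih (k := k - 2) (by omega)).below (j := k) [cap i]
      (by rw [isTangle_cap, isTangle_nil]; omega)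
    rw [show k - 2 + 2 - 2 * m = k + 2 - 2 * (m + 1) by omega] at h3
    simp only [List.append_assoc, List.singleton_append] at h2 h3
    exact h2.trans h3

theorem isotopic_curl_cap (b : Bool) (hk : i + 2 ≤ k) :
    Isotopic k (k - 2) (curl b (i + 1) ++ [cap i, cap i]) [cap i] := by
  have h1 := (isotopic_crossing_cap (k := k + 2) (i := i) b (by omega)).context (j := k)
    (m := k - 2) (u := [cup (i + 2)]) (v := [cap i]) ?_ ?_
  · have h2 := (isotopic_cup_crossing (k := k) (i := i) (j := i + 2) (!b) (by omega)
      (by omega)).above (m := k - 2) [cap (i + 1), cap i] ?_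
    · have h3 := (isotopic_cup_cap_right (k := k) (i := i + 1) (by omega)).context (j := k)
        (m := k - 2) (u := [crossing (!b) i]) (v := [cap i]) ?_ ?_
      · exact h1.trans (h2.trans (h3.trans (isotopic_crossing_cap_same (!b) hk)))
      all_goals simp only [IsTangle, Kind.inp, Kind.out]; omega
    · simp only [IsTangle, Kind.inp, Kind.out]; omega
  all_goals simp only [IsTangle, Kind.inp, Kind.out]; omega

theorem isotopic_curl_cap_right (b : Bool) (hk : i + 2 ≤ k) :
    Isotopic k (k - 2) (curl b (i + 1) ++ [cap (i + 1), cap i]) [cap i] := by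
  have h1 := (isotopic_crossing_cap_same (k := k + 2) (i := i + 1) b (by omega)).context (j := k)
    (m := k - 2) (u := [cup (i + 2)]) (v := [cap i]) ?_ ?_
  · have h2 := (isotopic_cup_cap_right (k := k) (i := i + 1) (by omega)).above
        (m := k - 2) [cap i] ?_
    · exact h1.trans h2
    · simp only [IsTangle, Kind.inp, Kind.out]; omega
  all_goals simp only [IsTangle, Kind.inp, Kind.out]; omega

/-- A curl turns the first pattern of the `H(n + 1)`-move into that of the `H(n)`-move. -/
theorem isotopic_curl_parallelCaps_succ (b : Bool) (hk : i + 2 * (m + 1) ≤ k) :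
    Isotopic k (k - 2 * (m + 1)) (curl b (i + 2 * m + 1) ++ parallelCaps (m + 2) i)
      (parallelCaps (m + 1) i) := by
  have h1 := (isotopic_curl_parallelCaps (i := i) (j := i + 1) (m := m) (k := k) b (by omega)
    (by omega)).above (m := k - 2 * (m + 1)) [cap i, cap i]
    (by simp only [IsTangle, Kind.inp, Kind.out]; omega)
  have h2 := (isotopic_curl_cap (k := k - 2 * m) (i := i) b (by omega)).below (j := k)
    (parallelCaps m i) ((isTangle_parallelCaps (by omega)).2 (by omega))
  rw [show k - 2 * m - 2 = k - 2 * (m + 1) by omega] at h2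
  rw [show i + 1 + 2 * m = i + 2 * m + 1 by omega] at h1
  simp only [parallelCaps, List.replicate_add, List.append_assoc] at h1 h2 ⊢
  exact h1.trans h2

/-- A curl turns the second pattern of the `H(n + 1)`-move into that of the `H(n)`-move. -/
theorem isotopic_curl_shiftedCaps_succ (b : Bool) (hk : i + 2 * (m + 1) ≤ k) :
    Isotopic k (k - 2 * (m + 1)) (curl b (i + 2 * m + 1) ++ shiftedCaps (m + 2) i)
      (shiftedCaps (m + 1) i) := by
  have h1 := (isotopic_curl_parallelCaps (i := i + 1) (j := i + 1) (m := m) (k := k) b (by omega)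
    (by omega)).above (m := k - 2 * (m + 1)) [cap (i + 1), cap i]
    (by simp only [IsTangle, Kind.inp, Kind.out]; omega)
  have h2 := (isotopic_curl_cap_right (k := k - 2 * m) (i := i) b (by omega)).below (j := k)
    (parallelCaps m (i + 1)) ((isTangle_parallelCaps (by omega)).2 (by omega))
  rw [show k - 2 * m - 2 = k - 2 * (m + 1) by omega] at h2
  rw [show i + 1 + 2 * m = i + 2 * m + 1 by omega] at h1
  simp only [shiftedCaps_succ, parallelCaps, List.replicate_add, List.append_assoc] at h1 h2 ⊢
  exact h1.trans h2

end

/-- The words of the diagrams that realize an edge of the Gordian graph. -/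
theorem exists_words {n : ℕ} (hn : 1 ≤ n) {K K' : Knot} (h : (gordianGraph n).Adj K K') :
    ∃ (u v : List Slice) (i k : ℕ) (h₁ : IsMonochromatic (u ++ parallelCaps n i ++ v))
      (h₂ : IsMonochromatic (u ++ shiftedCaps n i ++ v)),
      IsTangle 0 u k ∧ i + 2 * n ≤ k ∧ IsTangle (k - 2 * n) v 0 ∧
      (knotOf _ h₁ = K ∧ knotOf _ h₂ = K' ∨ knotOf _ h₁ = K' ∧ knotOf _ h₂ = K) := by
  have key : ∀ D D' : KnotDiagram, LocalMove (HPattern n) D D' →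
      ∃ (u v : List Slice) (i k : ℕ) (h₁ : IsMonochromatic (u ++ parallelCaps n i ++ v))
      (h₂ : IsMonochromatic (u ++ shiftedCaps n i ++ v)),
      IsTangle 0 u k ∧ i + 2 * n ≤ k ∧ IsTangle (k - 2 * n) v 0 ∧
      knotOf _ h₁ = D.knot ∧ knotOf _ h₂ = D'.knot := by
    rintro ⟨_, hD⟩ ⟨_, hD'⟩ ⟨u, _, _, v, ⟨i⟩, rfl, rfl⟩
    have h₁ := isKnotDiagram_iff.1 hD
    have h₂ := isKnotDiagram_iff.1 hD'
    obtain ⟨l, hl, hv⟩ := isTangle_append.1 h₁.1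
    obtain ⟨k, hu, ha⟩ := isTangle_append.1 hl
    have hk : i + 2 * n ≤ k := by
      clear * - ha hn
      induction n generalizing k with
      | zero => omega
      | succ n ih =>
        rw [List.replicate_succ, isTangle_cap] at ha
        obtain rfl | hn : n = 0 ∨ 1 ≤ n := by omega
        · omega
        · have := ih hn _ ha.2; omega
    have hl := (isTangle_parallelCaps hk).1 ha
    obtain rfl : l = k - 2 * n := by omega
    exact ⟨u, v, i, k, h₁, h₂, hu, hk, hv, rfl, rfl⟩
  obtain ⟨-, ⟨D, D', rfl, rfl, hm⟩ | ⟨D, D', rfl, rfl, hm⟩⟩ := (SimpleGraph.fromRel_adj _ _ _).1 h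
  · obtain ⟨u, v, i, k, h₁, h₂, hu, hk, hv, e, e'⟩ := key D D' hm
    exact ⟨u, v, i, k, h₁, h₂, hu, hk, hv, Or.inl ⟨e, e'⟩⟩
  · obtain ⟨u, v, i, k, h₁, h₂, hu, hk, hv, e, e'⟩ := key D D' hm
    exact ⟨u, v, i, k, h₁, h₂, hu, hk, hv, Or.inr ⟨e, e'⟩⟩

/-- An `H(n)`-move is an `H(n + 1)`-move, after a curl has been added to one of the strands. -/
theorem gordianGraph_le_succ {n : ℕ} (hn : 1 ≤ n) : gordianGraph n ≤ gordianGraph (n + 1) := by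
  intro K K' h
  obtain ⟨u, v, i, k, h₁, h₂, hu, hk, hv, hK⟩ := exists_words hn h
  obtain ⟨m, rfl⟩ := Nat.exists_eq_add_of_le' hn
  have e₁ := (isotopic_curl_parallelCaps_succ true hk).symm.context hu hv
  have e₂ := (isotopic_curl_shiftedCaps_succ true hk).symm.context hu hv
  rw [← List.append_assoc] at e₁ e₂
  have d := withinDist_one (n := m + 1 + 1) h₁ h₂ e₁ e₂
  have : WithinDist (gordianGraph (m + 1 + 1)) 1 K K' := by
    obtain ⟨rfl, rfl⟩ | ⟨rfl, rfl⟩ := hK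
    · exact d
    · exact d.symm
  obtain ⟨p, hp⟩ := this
  match p, hp with
  | .nil, _ => exact absurd rfl h.ne
  | .cons hadj .nil, _ => exact hadj
  | .cons _ (.cons _ _), hp => simp at hp

theorem gordianGraph_two_le {n : ℕ} (hn : 2 ≤ n) : gordianGraph 2 ≤ gordianGraph n := by
  induction n, hn using Nat.le_induction with
  | base => exact le_rfl
  | succ n hn ih => exact ih.trans (gordianGraph_le_succ (by omega))

/-- The distance in the `H(2)`-Gordian graph of the ends of an edge. -/
theorem dist_le_of_adj {n : ℕ} (hn : 1 ≤ n) {K K' : Knot} (h : (gordianGraph n).Adj K K') :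
    (gordianGraph 2).dist K K' ≤ 2 * n := by
  obtain ⟨u, v, i, k, h₁, h₂, hu, hk, hv, hK⟩ := exists_words hn h
  obtain ⟨m, rfl⟩ := Nat.exists_eq_add_of_le' hn
  obtain ⟨p, hp⟩ := withinDist_of_hMove hu hv hk h₁ h₂
  have := (SimpleGraph.dist_le p).trans hp
  obtain ⟨rfl, rfl⟩ | ⟨rfl, rfl⟩ := hK
  · omega
  · rw [SimpleGraph.dist_comm]; omega

/-! ### Quasi-isometries between graphs with the same vertices -/

section

variable {V : Type*} {G H : SimpleGraph V}

/-- A change of the edges distorts the distances at most by the distances between the ends of the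
edges. -/
theorem dist_le_mul_dist (hG : G.Connected) (hH : H.Connected) {c : ℕ}
    (h : ∀ v w, G.Adj v w → H.dist v w ≤ c) (v w : V) : H.dist v w ≤ c * G.dist v w := by
  obtain ⟨p, hp⟩ := hG.exists_walk_length_eq_dist v w
  rw [← hp]
  clear hp
  induction p with
  | nil => simp
  | cons hadj p ih =>
    rw [SimpleGraph.Walk.length_cons]
    have := hH.dist_triangle (u := _) (v := _) (w := _) |>.trans (Nat.add_le_add (h _ _ hadj) ih)
    rw [mul_add, mul_one, add_comm]
    exact this

namespace Realization

/-- A vertex as a point of the realization. -/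
noncomputable def vertex (G : SimpleGraph V) (v : V) : Realization G where
  coord := Finsupp.single v 1
  nonneg w := by
    classical
    rw [Finsupp.single_apply]; split_ifs <;> norm_num
  sum_eq_one := by simp
  card_support := (Finset.card_le_card Finsupp.support_single_subset).trans (by simp)
  adj_of_ne a ha b hb hab := by
    have ha := Finset.mem_singleton.1 (Finsupp.support_single_subset ha)
    have hb := Finset.mem_singleton.1 (Finsupp.support_single_subset hb)
    exact absurd (ha.trans hb.symm) hab

theorem support_nonempty (x : Realization G) : x.coord.support.Nonempty := by
  rw [Finset.nonempty_iff_ne_empty]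
  intro h
  have := x.sum_eq_one
  rw [Finsupp.sum, h] at this
  simp at this

theorem coord_le_one (x : Realization G) (v : V) : x.coord v ≤ 1 := by
  classical
  by_cases hv : v ∈ x.coord.support
  · rw [← x.sum_eq_one, Finsupp.sum]
    exact Finset.single_le_sum (f := fun w => x.coord w) (fun w _ => x.nonneg w) hv
  · rw [Finsupp.notMem_support_iff.1 hv]; norm_num

theorem dist_support_le (x : Realization G) {v w : V} (hv : v ∈ x.coord.support)
    (hw : w ∈ x.coord.support) : G.dist v w ≤ 1 := by
  by_cases h : v = w
  · simp [h]
  · exact (SimpleGraph.dist_eq_one_iff_adj.2 (x.adj_of_ne v hv w hw h)).le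

/-- The path metric differs by a bounded amount from the distance of nearby vertices. -/
theorem abs_dist_sub_le (hG : G.Connected) (x y : Realization G) {v w : V}
    (hv : v ∈ x.coord.support) (hw : w ∈ y.coord.support) :
    |dist x y - G.dist v w| ≤ 4 := by
  classical
  by_cases h : x.SameEdge y
  · have hd : dist x y = (∑ u ∈ x.coord.support ∪ y.coord.support,
        |x.coord u - y.coord u|) / 2 := by
      simp only [Dist.dist]
      rw [if_pos h]
    have hx : ∑ u ∈ x.coord.support ∪ y.coord.support, x.coord u = 1 := by
      rw [← x.sum_eq_one, Finsupp.sum]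
      exact (Finset.sum_subset Finset.subset_union_left
        fun u _ hu => Finsupp.notMem_support_iff.1 hu).symm
    have hy : ∑ u ∈ x.coord.support ∪ y.coord.support, y.coord u = 1 := by
      rw [← y.sum_eq_one, Finsupp.sum]
      exact (Finset.sum_subset Finset.subset_union_right
        fun u _ hu => Finsupp.notMem_support_iff.1 hu).symm
    have h0 : 0 ≤ ∑ u ∈ x.coord.support ∪ y.coord.support, |x.coord u - y.coord u| :=
      Finset.sum_nonneg fun _ _ => abs_nonneg _
    have h2 : ∑ u ∈ x.coord.support ∪ y.coord.support, |x.coord u - y.coord u| ≤ 1 + 1 := by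
      refine le_of_le_of_eq ?_ (congrArg₂ (· + ·) hx hy)
      rw [← Finset.sum_add_distrib]
      refine Finset.sum_le_sum fun u _ => abs_sub_le_iff.2 ⟨?_, ?_⟩ <;>
        linarith [x.nonneg u, y.nonneg u]
    have hvw : (G.dist v w : ℝ) ≤ 1 := by
      obtain ⟨a, b, hab, hs⟩ := h
      have hab' : G.dist a b ≤ 1 := by
        rcases hab with rfl | hab
        · simp
        · exact (SimpleGraph.dist_eq_one_iff_adj.2 hab).le
      have : G.dist v w ≤ 1 := by
        rcases hs v (Or.inl (Finsupp.mem_support_iff.1 hv)) with rfl | rfl <;>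
          rcases hs w (Or.inr (Finsupp.mem_support_iff.1 hw)) with rfl | rfl
        · simp
        · exact hab'
        · rwa [SimpleGraph.dist_comm]
        · simp
      exact_mod_cast this
    rw [hd, abs_le]
    constructor <;> linarith [(Nat.cast_nonneg (G.dist v w) : (0 : ℝ) ≤ _)]
  · have hd : dist x y = ⨅ p : x.coord.support × y.coord.support,
        (1 - x.coord p.1) + (G.dist (p.1 : V) (p.2 : V) : ℝ) + (1 - y.coord p.2) := by
      simp only [Dist.dist]
      rw [if_neg h]
    have : Nonempty (x.coord.support × y.coord.support) := ⟨⟨v, hv⟩, ⟨w, hw⟩⟩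
    have hlow : (G.dist v w : ℝ) - 2 ≤ dist x y := by
      rw [hd]
      refine le_ciInf fun ⟨⟨a, ha⟩, ⟨b, hb⟩⟩ => ?_
      have h1 : G.dist v w ≤ G.dist v a + (G.dist a b + G.dist b w) :=
        hG.dist_triangle.trans (Nat.add_le_add_left hG.dist_triangle _)
      have h2 := x.dist_support_le hv ha
      have h3 := y.dist_support_le hb hw
      have h4 : (G.dist v w : ℝ) ≤ 1 + (G.dist a b + 1) := by
        exact_mod_cast h1.trans (Nat.add_le_add h2 (Nat.add_le_add_left h3 _))
      have := x.coord_le_one a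
      have := y.coord_le_one b
      simp only
      linarith
    have hup : dist x y ≤ (1 - x.coord v) + (G.dist v w : ℝ) + (1 - y.coord w) := by
      rw [hd]
      exact ciInf_le (Set.finite_range _).bddBelow
        ((⟨v, hv⟩, ⟨w, hw⟩) : x.coord.support × y.coord.support)
    have := x.nonneg v
    have := y.nonneg w
    rw [abs_le]
    constructor <;> linarith

end Realization

/-- Connected graphs on the same vertices are quasi-isometric if the ends of an edge of one graph
have a bounded distance in the other. -/
theorem quasiIsometric_of_dist_le (hG : G.Connected) (hH : H.Connected) {c : ℕ} (hc : 1 ≤ c)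
    (hGH : ∀ v w, G.Adj v w → H.dist v w ≤ c) (hHG : ∀ v w, H.Adj v w → G.dist v w ≤ 1) :
    QuasiIsometric (Realization G) (Realization H) := by
  choose s hs using fun x : Realization G => x.support_nonempty
  have hv : ∀ v, v ∈ (Realization.vertex H v).coord.support := fun v => by
    simp [Realization.vertex]
  refine ⟨fun x => .vertex H (s x), c, 4 * c + 4, 4, by exact_mod_cast hc, by positivity,
    by norm_num, fun x x' => ?_, fun y => ?_⟩
  · have h1 := abs_le.1 (Realization.abs_dist_sub_le hG x x' (hs x) (hs x'))
    have h2 := abs_le.1 (Realization.abs_dist_sub_le hH _ _ (hv (s x)) (hv (s x')))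
    have h3 : (H.dist (s x) (s x') : ℝ) ≤ c * G.dist (s x) (s x') := by
      exact_mod_cast dist_le_mul_dist hG hH hGH _ _
    have h4 : (G.dist (s x) (s x') : ℝ) ≤ H.dist (s x) (s x') := by
      have := dist_le_mul_dist hH hG hHG (s x) (s x')
      rw [one_mul] at this
      exact_mod_cast this
    have hc' : (1 : ℝ) ≤ c := by exact_mod_cast hc
    constructor
    · have h5 : 1 / (c : ℝ) * dist x x' ≤ G.dist (s x) (s x') + 4 := by
        rw [one_div, inv_mul_le_iff₀ (by linarith)]
        have h6 : (0 : ℝ) ≤ G.dist (s x) (s x') + 4 := by positivity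
        nlinarith [h1.2]
      linarith [h2.1]
    · have h5 : (c : ℝ) * G.dist (s x) (s x') ≤ c * (dist x x' + 4) :=
        mul_le_mul_of_nonneg_left (by linarith [h1.1]) (by linarith)
      linarith [h2.2]
  · obtain ⟨w, hw⟩ := y.support_nonempty
    refine ⟨.vertex G w, ?_⟩
    have hsw : s (.vertex G w) = w :=
      Finset.mem_singleton.1 (Finsupp.support_single_subset (hs (.vertex G w)))
    have := abs_le.1 (Realization.abs_dist_sub_le hH y (.vertex H w) hw (hv w))
    rw [SimpleGraph.dist_self, Nat.cast_zero, sub_zero] at this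
    simpa only [hsw] using this.2

end

end KnotTheory

theorem corollary2p5 (n : ℕ) (hn : 3 ≤ n) :
    (KnotTheory.gordianGraph n).Connected ∧ (KnotTheory.gordianGraph 2).Connected ∧
      KnotTheory.QuasiIsometric (KnotTheory.Realization (KnotTheory.gordianGraph n))
        (KnotTheory.Realization (KnotTheory.gordianGraph 2)) := by
  have h₂ := KnotTheory.gordianGraph_two_connected
  have hle := KnotTheory.gordianGraph_two_le (n := n) (by omega)
  have hn' := h₂.mono hle
  exact ⟨hn', h₂, KnotTheory.quasiIsometric_of_dist_le hn' h₂ (c := 2 * n) (by omega)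
    (fun _ _ h => KnotTheory.dist_le_of_adj (by omega) h)
    (fun _ _ h => (SimpleGraph.dist_eq_one_iff_adj.2 (hle h)).le)⟩
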